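/- Let $(\mathcal S,P,r,\gamma)$ be a Markov reward process: $\mathcal S$ is a compact space, $P$ a Markov transition kernel on $\mathcal S$ that is ergodic with a stationary probability measure $\mu$ of full support, $r:\mathcal S\times\mathcal S\to\mathbb R$ is bounded (and measurable), and $\gamma\in(0,1)$. Write $\mathbb E_s$ for the expectation over the Markov process $(s_t)_{t\ge 0}$ with kernel $P$ and $s_0=s$, and $\langle\cdot,\cdot\rangle_\mu$, $\|\cdot\|_\mu$ for the inner product and norm of $L^2(\mathcal S,\mu)$. Let $V^*(s)=\mathbb E_s\big[\sum_{t\ge 0}\gamma^t r(s_t,s_{t+1})\big]$ and, for $\lambda\in[0,1)$, let $T^\lambda:L^2(\mathcal S,\mu)\to L^2(\mathcal S,\mu)$, $$T^\lambda v(s)=(1-\lambda)\sum_{m\ge 0}\lambda^m\,\mathbb E_s\Big[\sum_{t=0}^m\gamma^t r(s_t,s_{t+1})+\gamma^{m+1}v(s_{m+1})\Big].$$ Let $V:\mathbb R^p\to L^2(\mathcal S,\mu)$, $w\mapsto V_w$, be differentiable with Lipschitz continuous derivative $w\mapsto DV_w$. For $\alpha>0$ consider the scaled TD($\lambda$) dynamics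 on $\mathbb R^p$ $$\frac{d}{dt}w(t)=X_\alpha(w(t)),\qquad X_\alpha(w):=\frac1\alpha\big\langle T^\lambda(\alpha V_{w})-\alpha V_{w},\,DV_{w}\big\rangle_\mu\qquad(\ast)$$ (the $i$-th coordinate of the right-hand side pairs with $\partial_iV_w$). For $w\in\mathbb R^p$ let $\Pi_w$ be the $\langle\cdot,\cdot\rangle_\mu$-orthogonal projection onto the tangent space $\operatorname{range}(DV_w)$. Let $w_0\in\mathbb R^p$ be such that $\operatorname{rank}(DV_w)$ is constant for $w$ in a neighborhood of $w_0$ and $V_{w_0}=0$. Then there are constants $\alpha_0,\rho,c,K,C>0$, not depending on $\alpha$, such that for every $\alpha>\alpha_0$ there is a point $w^*$ with $\|w^*-w_0\|<\rho$ and $X_\alpha(w^*)=0$ for which, with $\tilde V^*:=\alpha V_{w^*}$: 1. $(\ast)$ has a solution on $[0,\infty)$ with $w(0)=w_0$, and every such solution satisfies $\|w(t)-w^*\|\le Ke^{-ct}$ and $\|\alpha V_{w(t)}-\tilde V^*\|_\mu\le Ke^{-ct}$ for all $t\ge0$; 2. $\tilde V^*$ is locally (in parameter space) attractive: for every $w_1$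 with $\|w_1-w_0\|<\rho$, $(\ast)$ has a solution on $[0,\infty)$ with $w(0)=w_1$, and for every such solution $\|\alpha V_{w(t)}-\tilde V^*\|_\mu\le K\|\alpha V_{w_1}-\tilde V^*\|_\mu e^{-ct}$ for all $t\ge0$, and there is $w_\infty$ with $X_\alpha(w_\infty)=0$, $\alpha V_{w_\infty}=\tilde V^*$ and $\|w(t)-w_\infty\|\le Ke^{-ct}$ for all $t\ge0$; 3. the projected TD error vanishes: $\|\Pi_{w^*}(T^\lambda\tilde V^*-\tilde V^*)\|_\mu=0$; 4. $\displaystyle\|\tilde V^*-V^*\|_\mu<\frac{1-\lambda\gamma}{1-\gamma}\,\|\Pi_{w_0}V^*-V^*\|_\mu+\frac C\alpha .$ -/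

import Mathlib

open MeasureTheory ProbabilityTheory Filter Topology
open scoped ENNReal NNReal

/-- A Markov reward process `(S, P, r, γ)`: a Markov transition kernel `P` on `S`, a bounded
measurable immediate reward `r`, and a discount factor `γ ∈ (0,1)`. -/
structure MarkovRewardProcess (S : Type*) [MeasurableSpace S] where
  /-- the transition kernel -/
  P : Kernel S S
  isMarkov : IsMarkovKernel P
  /-- the immediate reward of a transition -/
  r : S → S → ℝ
  measurable_r : Measurable (Function.uncurry r)
  bounded_r : ∃ R : ℝ, ∀ s s', |r s s'| ≤ R
  /-- the discount factor -/
  γ : ℝ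
  γ_pos : 0 < γ
  γ_lt_one : γ < 1

namespace MarkovRewardProcess

variable {S : Type*} [MeasurableSpace S]

/-- `μ` is a stationary probability measure of the process under which the process is ergodic:
every almost surely invariant set has measure `0` or `1`. -/
structure IsErgodic (M : MarkovRewardProcess S) (μ : Measure S) : Prop where
  isProbability : IsProbabilityMeasure μ
  invariant : Kernel.Invariant M.P μ
  ergodic : ∀ A : Set S, MeasurableSet A →
    (∀ᵐ s ∂μ, M.P s A = A.indicator (fun _ => (1 : ℝ≥0∞)) s) → μ A = 0 ∨ μ A = 1

/-- The transition from the history `(s₀, …, sₙ)` to `sₙ₊₁`, which depends on `sₙ` only. -/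
noncomputable def step (M : MarkovRewardProcess S) (n : ℕ) :
    Kernel ((i : Finset.Iic n) → (fun _ : ℕ => S) i) S :=
  M.P.comap (fun x => x ⟨n, Finset.mem_Iic.2 le_rfl⟩) (measurable_pi_apply _)

instance (M : MarkovRewardProcess S) (n : ℕ) : IsMarkovKernel (M.step n) := by
  have := M.isMarkov
  unfold step
  infer_instance

/-- The law, on the space of trajectories `(s₀, s₁, …)`, of the Markov process started at `s`.
The expectation `𝔼_s` is integration against `M.path s`. -/
noncomputable def path (M : MarkovRewardProcess S) : Kernel S (ℕ → S) :=
  (Kernel.traj (X := fun _ => S) M.step 0).comap (fun s _ => s)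
    (measurable_pi_lambda _ fun _ => measurable_id)

instance (M : MarkovRewardProcess S) : IsMarkovKernel M.path := by
  unfold path
  infer_instance

/-- The value function `V*(s) = 𝔼_s[∑ₜ γᵗ r(sₜ, sₜ₊₁)]`. -/
noncomputable def valueFun (M : MarkovRewardProcess S) (s : S) : ℝ :=
  ∫ ω, ∑' t : ℕ, M.γ ^ t * M.r (ω t) (ω (t + 1)) ∂(M.path s)

/-- The TD operator on functions,
`T^λ v(s) = (1-λ) ∑ₘ λᵐ 𝔼_s[∑_{t ≤ m} γᵗ r(sₜ, sₜ₊₁) + γ^{m+1} v(sₘ₊₁)]`. -/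
noncomputable def tdFun (M : MarkovRewardProcess S) (lam : ℝ) (v : S → ℝ) (s : S) : ℝ :=
  (1 - lam) * ∑' m : ℕ, lam ^ m *
    ∫ ω, ((∑ t ∈ Finset.range (m + 1), M.γ ^ t * M.r (ω t) (ω (t + 1)))
      + M.γ ^ (m + 1) * v (ω (m + 1))) ∂(M.path s)

open Classical in
/-- The value function as an element of `L²(S, μ)`. The first branch is always the case,
see `memLp_valueFun`. -/
noncomputable def value (M : MarkovRewardProcess S) (μ : Measure S) : Lp ℝ 2 μ :=
  if h : MemLp M.valueFun 2 μ then h.toLp _ else 0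

open Classical in
/-- The TD operator `T^λ : L²(S, μ) → L²(S, μ)`. The first branch is always the case when `μ`
is stationary and `λ ∈ [0,1)`, see `memLp_tdFun`. -/
noncomputable def td (M : MarkovRewardProcess S) (μ : Measure S) (lam : ℝ) (v : Lp ℝ 2 μ) :
    Lp ℝ 2 μ :=
  if h : MemLp (M.tdFun lam v) 2 μ then h.toLp _ else 0

theorem memLp_valueFun (M : MarkovRewardProcess S) (μ : Measure S) [IsProbabilityMeasure μ] :
    MemLp M.valueFun 2 μ := by
  obtain ⟨R, hR⟩ := M.bounded_r
  have hr := M.measurable_r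
  have hmeas : Measurable fun ω : ℕ → S => ∑' t : ℕ, M.γ ^ t * M.r (ω t) (ω (t + 1)) := by
    refine Measurable.tsum fun t => ?_
    have : Measurable fun ω : ℕ → S => Function.uncurry M.r (ω t, ω (t + 1)) :=
      hr.comp ((measurable_pi_apply t).prodMk (measurable_pi_apply (t + 1)))
    exact this.const_mul _
  have hsm : StronglyMeasurable M.valueFun :=
    StronglyMeasurable.integral_kernel hmeas.stronglyMeasurable
  refine MemLp.of_bound hsm.aestronglyMeasurable ((1 - M.γ)⁻¹ * R) (ae_of_all _ fun s => ?_)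
  have hb : ∀ ω : ℕ → S, ‖∑' t : ℕ, M.γ ^ t * M.r (ω t) (ω (t + 1))‖ ≤ (1 - M.γ)⁻¹ * R := by
    intro ω
    have hg := (hasSum_geometric_of_lt_one M.γ_pos.le M.γ_lt_one).mul_right R
    refine tsum_of_norm_bounded hg fun t => ?_
    rw [norm_mul, Real.norm_eq_abs, Real.norm_eq_abs, abs_of_nonneg (pow_nonneg M.γ_pos.le t)]
    exact mul_le_mul_of_nonneg_left (hR _ _) (pow_nonneg M.γ_pos.le t)
  refine (norm_integral_le_of_norm_le_const (ae_of_all _ hb)).trans ?_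
  simp

theorem path_map_zero (M : MarkovRewardProcess S) :
    M.path.map (fun ω => ω 0) = Kernel.id := by
  ext s : 1
  rw [Kernel.map_apply _ (measurable_pi_apply 0), path, Kernel.comap_apply]
  have : (fun ω : ℕ → S => ω 0) = (fun x : (i : Finset.Iic 0) → S =>
      x ⟨0, Finset.mem_Iic.2 le_rfl⟩) ∘ Preorder.frestrictLe (π := fun _ : ℕ => S) 0 := rfl
  have hm : Measurable (fun x : (i : Finset.Iic 0) → S => x ⟨0, Finset.mem_Iic.2 le_rfl⟩) :=
    measurable_pi_apply _
  rw [this, ← Measure.map_map hm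
    (Preorder.measurable_frestrictLe 0), Kernel.traj_map_frestrictLe_apply,
    Kernel.partialTraj_self, Kernel.id_apply, Kernel.id_apply]
  exact Measure.map_dirac' hm _

theorem path_map_succ (M : MarkovRewardProcess S) (n : ℕ) :
    M.path.map (fun ω => ω (n + 1)) = M.P ∘ₖ M.path.map (fun ω => ω n) := by
  have := M.isMarkov
  ext s : 1
  have hm : Measurable (fun x : (i : Finset.Iic n) → S => x ⟨n, Finset.mem_Iic.2 le_rfl⟩) :=
    measurable_pi_apply _
  have e1 : (fun ω : ℕ → S => ω n) = (fun x : (i : Finset.Iic n) → S =>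
      x ⟨n, Finset.mem_Iic.2 le_rfl⟩) ∘ Preorder.frestrictLe (π := fun _ : ℕ => S) n := rfl
  have e2 : Kernel.traj (X := fun _ => S) M.step 0 = Kernel.traj (X := fun _ => S) M.step n ∘ₖ
      Kernel.partialTraj (X := fun _ => S) M.step 0 n :=
    (Kernel.traj_comp_partialTraj (Nat.zero_le n)).symm
  have e3 : M.step n = M.P ∘ₖ Kernel.deterministic _ hm := by
    rw [Kernel.comp_deterministic_eq_comap]; rfl
  have e4 : (Kernel.traj (X := fun _ => S) M.step 0).map (fun ω => ω (n + 1)) =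
      M.P ∘ₖ (Kernel.traj (X := fun _ => S) M.step 0).map (fun ω => ω n) := by
    conv_lhs => rw [e2]
    rw [Kernel.map_comp, Kernel.map_traj_succ_self, e3, e1,
      Kernel.map_comp_right _ (Preorder.measurable_frestrictLe n) hm,
      Kernel.traj_map_frestrictLe, Kernel.comp_assoc, Kernel.deterministic_comp_eq_map]
  have e5 := DFunLike.congr_fun e4 (fun _ => s)
  rw [Kernel.map_apply _ (measurable_pi_apply _), Kernel.comp_apply,
    Kernel.map_apply _ (measurable_pi_apply _)] at e5
  rw [Kernel.map_apply _ (measurable_pi_apply _), Kernel.comp_apply,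
    Kernel.map_apply _ (measurable_pi_apply _), path, Kernel.comap_apply]
  exact e5

/-- The law of `sₙ` is stationary if that of `s₀` is. -/
theorem bind_path_map (M : MarkovRewardProcess S) (μ : Measure S)
    (hμ : Kernel.Invariant M.P μ) (n : ℕ) :
    μ.bind (M.path.map fun ω => ω n) = μ := by
  induction n with
  | zero =>
    rw [path_map_zero]
    exact Measure.bind_dirac
  | succ n ih =>
    rw [path_map_succ, ← Measure.comp_assoc, ih]
    exact hμ

theorem lintegral_lintegral_path (M : MarkovRewardProcess S) (μ : Measure S)
    (hμ : Kernel.Invariant M.P μ) (n : ℕ) {f : S → ℝ≥0∞} (hf : Measurable f) :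
    ∫⁻ s, ∫⁻ ω, f (ω n) ∂(M.path s) ∂μ = ∫⁻ s, f s ∂μ := by
  conv_rhs => rw [← bind_path_map M μ hμ n]
  rw [Measure.lintegral_bind (Kernel.aemeasurable _) hf.aemeasurable]
  refine lintegral_congr fun s => ?_
  rw [Kernel.map_apply _ (measurable_pi_apply n), lintegral_map hf (measurable_pi_apply n)]

theorem memLp_tdFun (M : MarkovRewardProcess S) (μ : Measure S) [IsProbabilityMeasure μ]
    (hμ : Kernel.Invariant M.P μ) {lam : ℝ} (h0 : 0 ≤ lam) (h1 : lam < 1) (v : Lp ℝ 2 μ) :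
    MemLp (M.tdFun lam v) 2 μ := by
  obtain ⟨R, hR⟩ := M.bounded_r
  have hr := M.measurable_r
  have hv : StronglyMeasurable (v : S → ℝ) := Lp.stronglyMeasurable v
  have hγ := M.γ_pos
  have hγ1 := M.γ_lt_one
  have hsum : ∀ m : ℕ, Measurable fun ω : ℕ → S =>
      ∑ t ∈ Finset.range (m + 1), M.γ ^ t * M.r (ω t) (ω (t + 1)) := by
    intro m
    refine Finset.measurable_fun_sum _ fun t _ => ?_
    have : Measurable fun ω : ℕ → S => Function.uncurry M.r (ω t, ω (t + 1)) :=
      hr.comp ((measurable_pi_apply t).prodMk (measurable_pi_apply (t + 1)))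
    exact this.const_mul _
  have hf : ∀ m : ℕ, Measurable fun ω : ℕ → S =>
      (∑ t ∈ Finset.range (m + 1), M.γ ^ t * M.r (ω t) (ω (t + 1)))
        + M.γ ^ (m + 1) * v (ω (m + 1)) := fun m =>
    (hsum m).add ((hv.measurable.comp (measurable_pi_apply (m + 1))).const_mul _)
  have hmeas : Measurable (M.tdFun lam v) := by
    unfold tdFun
    refine (Measurable.tsum fun m => ?_).const_mul _
    exact (StronglyMeasurable.integral_kernel (hf m).stronglyMeasurable).measurable.const_mul _
  -- bound of the reward part
  obtain ⟨B, hB⟩ : ∃ B : ℝ≥0, ∀ (m : ℕ) (ω : ℕ → S),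
      ‖∑ t ∈ Finset.range (m + 1), M.γ ^ t * M.r (ω t) (ω (t + 1))‖ₑ ≤ B := by
    refine ⟨((1 - M.γ)⁻¹ * |R|).toNNReal, fun m ω => ?_⟩
    have hg := hasSum_geometric_of_lt_one hγ.le hγ1
    have : ‖∑ t ∈ Finset.range (m + 1), M.γ ^ t * M.r (ω t) (ω (t + 1))‖
        ≤ (1 - M.γ)⁻¹ * |R| := by
      calc _ ≤ ∑ t ∈ Finset.range (m + 1), ‖M.γ ^ t * M.r (ω t) (ω (t + 1))‖ :=
            norm_sum_le _ _
        _ ≤ ∑ t ∈ Finset.range (m + 1), M.γ ^ t * |R| := by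
            refine Finset.sum_le_sum fun t _ => ?_
            rw [norm_mul, Real.norm_eq_abs, Real.norm_eq_abs,
              abs_of_nonneg (pow_nonneg hγ.le t)]
            exact mul_le_mul_of_nonneg_left ((hR _ _).trans (le_abs_self R))
              (pow_nonneg hγ.le t)
        _ = (∑ t ∈ Finset.range (m + 1), M.γ ^ t) * |R| := by rw [Finset.sum_mul]
        _ ≤ _ := by
            refine mul_le_mul_of_nonneg_right ?_ (abs_nonneg R)
            rw [← hg.tsum_eq]
            exact hg.summable.sum_le_tsum _ fun t _ => pow_nonneg hγ.le t
    rw [← ofReal_norm]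
    exact ENNReal.ofReal_le_ofReal this
  -- the averaging kernel of the eligibility trace
  let w : ℕ → ℝ≥0∞ := fun m => ENNReal.ofReal ((1 - lam) * lam ^ m)
  have hw : ∑' m, w m = 1 := by
    have hs : HasSum (fun m : ℕ => (1 - lam) * lam ^ m) 1 := by
      have := (hasSum_geometric_of_lt_one h0 h1).mul_left (1 - lam)
      rwa [mul_inv_cancel₀ (by linarith)] at this
    have := ENNReal.ofReal_tsum_of_nonneg
      (fun m => mul_nonneg (by linarith) (pow_nonneg h0 m)) hs.summable
    rw [hs.tsum_eq, ENNReal.ofReal_one] at this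
    exact this.symm
  let K : S → Measure S := fun s =>
    Measure.sum fun m => w m • (M.path s).map fun ω => ω (m + 1)
  have hK : ∀ (s : S) {f : S → ℝ≥0∞}, Measurable f →
      ∫⁻ x, f x ∂(K s) = ∑' m, w m * ∫⁻ ω, f (ω (m + 1)) ∂(M.path s) := by
    intro s f hf
    simp only [K]
    rw [lintegral_sum_measure]
    refine tsum_congr fun m => ?_
    rw [lintegral_smul_measure, lintegral_map hf (measurable_pi_apply _), smul_eq_mul]
  have hKp : ∀ s, IsProbabilityMeasure (K s) := by
    intro s
    refine ⟨?_⟩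
    have := hK s (f := fun _ => 1) measurable_const
    simpa [hw] using this
  have hve : Measurable fun x => ‖v x‖ₑ := hv.measurable.enorm
  have hb : ∀ s, ‖M.tdFun lam v s‖ₑ ≤ B + ∫⁻ x, ‖v x‖ₑ ∂(K s) := by
    intro s
    rw [hK s hve]
    have key : ∀ m : ℕ, ‖lam ^ m * ∫ ω, ((∑ t ∈ Finset.range (m + 1),
        M.γ ^ t * M.r (ω t) (ω (t + 1))) + M.γ ^ (m + 1) * v (ω (m + 1))) ∂(M.path s)‖ₑ ≤
        ENNReal.ofReal (lam ^ m) * (B + ∫⁻ ω, ‖v (ω (m + 1))‖ₑ ∂(M.path s)) := by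
      intro m
      rw [enorm_mul, Real.enorm_of_nonneg (pow_nonneg h0 m)]
      gcongr
      refine (enorm_integral_le_lintegral_enorm _).trans ?_
      have : ∫⁻ _ω, (B : ℝ≥0∞) ∂(M.path s) = B := by simp
      rw [← this, ← lintegral_add_left measurable_const]
      refine lintegral_mono fun ω => ?_
      refine (enorm_add_le _ _).trans ?_
      gcongr
      · exact hB m ω
      · rw [enorm_mul, Real.enorm_of_nonneg (pow_nonneg hγ.le _)]
        refine mul_le_of_le_one_left (by positivity) ?_
        rw [← ENNReal.ofReal_one]
        exact ENNReal.ofReal_le_ofReal (pow_le_one₀ hγ.le hγ1.le)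
    calc ‖M.tdFun lam v s‖ₑ
        ≤ ENNReal.ofReal (1 - lam) * ∑' m : ℕ, ENNReal.ofReal (lam ^ m) *
            (B + ∫⁻ ω, ‖v (ω (m + 1))‖ₑ ∂(M.path s)) := by
          unfold tdFun
          rw [enorm_mul, Real.enorm_of_nonneg (by linarith)]
          gcongr
          exact enorm_tsum_le_tsum_enorm.trans (ENNReal.tsum_le_tsum key)
      _ = ∑' m : ℕ, w m * (B + ∫⁻ ω, ‖v (ω (m + 1))‖ₑ ∂(M.path s)) := by
          rw [← ENNReal.tsum_mul_left]
          refine tsum_congr fun m => ?_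
          rw [← mul_assoc, ← ENNReal.ofReal_mul (by linarith)]
      _ = B + ∑' m : ℕ, w m * ∫⁻ ω, ‖v (ω (m + 1))‖ₑ ∂(M.path s) := by
          simp_rw [mul_add]
          rw [ENNReal.tsum_add, ENNReal.tsum_mul_right, hw, one_mul]
  -- Jensen's inequality and stationarity
  have hvint : ∫⁻ x, ‖v x‖ₑ ^ (2 : ℝ) ∂μ < ∞ := by
    have := lintegral_rpow_enorm_lt_top_of_eLpNorm_lt_top (p := 2) (by simp) (by simp)
      (Lp.memLp v).2
    simpa using this
  have hJ : ∀ s, (∫⁻ x, ‖v x‖ₑ ∂(K s)) ^ (2 : ℝ) ≤ ∫⁻ x, ‖v x‖ₑ ^ (2 : ℝ) ∂(K s) := by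
    intro s
    have := hKp s
    have h := ENNReal.lintegral_mul_le_Lp_mul_Lq (K s) Real.HolderConjugate.two_two
      hve.aemeasurable (aemeasurable_const (b := (1 : ℝ≥0∞)))
    simp only [Pi.mul_apply, mul_one, ENNReal.one_rpow, lintegral_const, measure_univ] at h
    calc _ ≤ ((∫⁻ x, ‖v x‖ₑ ^ (2 : ℝ) ∂(K s)) ^ (1 / (2 : ℝ))) ^ (2 : ℝ) := by gcongr
      _ = _ := by rw [← ENNReal.rpow_mul]; norm_num
  have hKint : ∫⁻ s, ∫⁻ x, ‖v x‖ₑ ^ (2 : ℝ) ∂(K s) ∂μ = ∫⁻ x, ‖v x‖ₑ ^ (2 : ℝ) ∂μ := by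
    have hm2 : Measurable fun x => ‖v x‖ₑ ^ (2 : ℝ) := hve.pow_const _
    have hmm : ∀ m : ℕ, Measurable fun s => ∫⁻ ω, ‖v (ω (m + 1))‖ₑ ^ (2 : ℝ) ∂(M.path s) :=
      fun m => Measurable.lintegral_kernel (hm2.comp (measurable_pi_apply (m + 1)))
    simp_rw [hK _ hm2]
    rw [lintegral_tsum fun m => ((hmm m).const_mul _).aemeasurable]
    have : ∀ m : ℕ, ∫⁻ s, w m * ∫⁻ ω, ‖v (ω (m + 1))‖ₑ ^ (2 : ℝ) ∂(M.path s) ∂μ =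
        w m * ∫⁻ x, ‖v x‖ₑ ^ (2 : ℝ) ∂μ := by
      intro m
      rw [lintegral_const_mul _ (hmm m), lintegral_lintegral_path M μ hμ (m + 1) hm2]
    simp_rw [this]
    rw [ENNReal.tsum_mul_right, hw, one_mul]
  refine ⟨hmeas.aestronglyMeasurable, ?_⟩
  rw [eLpNorm_lt_top_iff_lintegral_rpow_enorm_lt_top (by simp) (by simp)]
  simp only [ENNReal.toReal_ofNat]
  calc ∫⁻ s, ‖M.tdFun lam v s‖ₑ ^ (2 : ℝ) ∂μ
      ≤ ∫⁻ s, (2 * (B : ℝ≥0∞) ^ (2 : ℝ) + 2 * ∫⁻ x, ‖v x‖ₑ ^ (2 : ℝ) ∂(K s)) ∂μ := by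
        refine lintegral_mono fun s => ?_
        calc ‖M.tdFun lam v s‖ₑ ^ (2 : ℝ) ≤ (B + ∫⁻ x, ‖v x‖ₑ ∂(K s)) ^ (2 : ℝ) := by
              gcongr; exact hb s
          _ ≤ 2 ^ ((2 : ℝ) - 1) * ((B : ℝ≥0∞) ^ (2 : ℝ) + (∫⁻ x, ‖v x‖ₑ ∂(K s)) ^ (2 : ℝ)) :=
              ENNReal.rpow_add_le_mul_rpow_add_rpow _ _ (by norm_num)
          _ = 2 * (B : ℝ≥0∞) ^ (2 : ℝ) + 2 * (∫⁻ x, ‖v x‖ₑ ∂(K s)) ^ (2 : ℝ) := by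
              norm_num [mul_add]
          _ ≤ _ := by gcongr; exact hJ s
    _ = 2 * (B : ℝ≥0∞) ^ (2 : ℝ) + 2 * ∫⁻ x, ‖v x‖ₑ ^ (2 : ℝ) ∂μ := by
        rw [lintegral_add_left measurable_const,
          lintegral_const_mul' 2 (fun s => ∫⁻ x, ‖v x‖ₑ ^ (2 : ℝ) ∂(K s)) (by simp), hKint]
        simp
    _ < ∞ := by
        refine ENNReal.add_lt_top.2 ⟨ENNReal.mul_lt_top (by simp) ?_,
          ENNReal.mul_lt_top (by simp) hvint⟩
        exact ENNReal.rpow_lt_top_of_nonneg (by norm_num) ENNReal.coe_ne_top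

/-- The right-hand side of the scaled, averaged TD(λ) dynamics of a parametric model `V`,
`(1/α) ⟨T^λ(α V_w) - α V_w, DV_w⟩_μ`: its `i`-th coordinate is `1/α` times the `L²(μ)` inner
product of `T^λ(α V_w) - α V_w` with `∂ᵢ V_w`, that is, the transpose of `DV_w` is applied. -/
noncomputable def tdField (M : MarkovRewardProcess S) (μ : Measure S) (lam : ℝ) {p : ℕ}
    (V : EuclideanSpace ℝ (Fin p) → Lp ℝ 2 μ) (α : ℝ) (w : EuclideanSpace ℝ (Fin p)) :
    EuclideanSpace ℝ (Fin p) :=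
  (1 / α) • ContinuousLinearMap.adjoint (fderiv ℝ V w) (M.td μ lam (α • V w) - α • V w)

/-- `w` solves the scaled TD(λ) dynamics for all times `t ≥ 0`. -/
def IsTDSolution (M : MarkovRewardProcess S) (μ : Measure S) (lam : ℝ) {p : ℕ}
    (V : EuclideanSpace ℝ (Fin p) → Lp ℝ 2 μ) (α : ℝ) (w : ℝ → EuclideanSpace ℝ (Fin p)) : Prop :=
  ∀ t ∈ Set.Ici (0 : ℝ), HasDerivWithinAt w (M.tdField μ lam V α (w t)) (Set.Ici 0) t

end MarkovRewardProcess

/-- The tangent space at `V_w` of the image of a parametric model `V`: the range of `DV_w`. -/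
noncomputable def modelTangent {p : ℕ} {F : Type*} [NormedAddCommGroup F] [InnerProductSpace ℝ F]
    (V : EuclideanSpace ℝ (Fin p) → F) (w : EuclideanSpace ℝ (Fin p)) : Submodule ℝ F :=
  LinearMap.range (fderiv ℝ V w : EuclideanSpace ℝ (Fin p) →ₗ[ℝ] F)

instance {p : ℕ} {F : Type*} [NormedAddCommGroup F] [InnerProductSpace ℝ F]
    (V : EuclideanSpace ℝ (Fin p) → F) (w : EuclideanSpace ℝ (Fin p)) :
    FiniteDimensional ℝ (modelTangent V w) := by
  unfold modelTangent
  infer_instance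

/-- The orthogonal projection of `F` onto the tangent space of the model at `V_w`. -/
noncomputable def tangentProj {p : ℕ} {F : Type*} [NormedAddCommGroup F] [InnerProductSpace ℝ F]
    (V : EuclideanSpace ℝ (Fin p) → F) (w : EuclideanSpace ℝ (Fin p)) : F →L[ℝ] F :=
  (modelTangent V w).starProjection

/-!
The TD operator `T` is a contraction of `L²(μ)` with modulus `k = γ (1 - λ) / (1 - λ γ) < 1`
(`MarkovRewardProcess.norm_td_sub_le`): it averages a function over a discounted law of the state at
a geometric time, and stationarity of `μ` turns Cauchy-Schwarz at each state into a bound in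
`L²(μ)`. Its fixed point is the value function, by the Markov property
(`MarkovRewardProcess.td_value`). Nothing else about the process is needed.

Put `S v = v - (1/α) T (α v)`. Whatever `α` is, `S` is `2`-Lipschitz and strongly monotone with
modulus `1 - k`, and `S 0 = O(1/α)`. The TD field is `-DV_w^* S (V_w)`.

As the rank of `DV` is constant near `w₀`, the model factors there as `V = g ∘ Φ` with a chart `Φ`
of the parameter space, where `g z` depends only on an orthogonal projection `P z`
(`exists_rankChart`). In the chart the equilibrium equation is `F z = 0` with
`F z = Dg_z^* S (g z)`. Since `V w₀ = 0`, near the origin `S (g z)` is small and `Dg_z` hardly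
varies, so `F` is strongly monotone in `P z`; it has a zero `zStar = O(1/α)`
(`RankChart.exists_zero_residual`). The chart has derivative the identity at `w₀`, so along
the dynamics `‖P (Φ w - zStar)‖²` decays at an exponential rate (`RankChart.exists_lyapunov`). The
velocity is bounded by `‖P (Φ w - zStar)‖`, so trajectories have finite length, stay near `w₀` and
converge (`exists_limit_of_lyapunov`). On the fibre `P (Φ w) = P zStar` the model is constant,
which is why all the limits share the value `V wStar`, and the trajectory of `w₀` has length
`O(1/α)`.

Finally `V` agrees with its tangent map at `w₀` up to second order, so `α V wStar` is, up to
`O(1/α)`, a fixed point of the contraction `Π ∘ T`, where `Π` is the projection onto the tangent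
space at `w₀`; the usual comparison of this fixed point with that of `T` yields the factor
`1 / (1 - k)` (`exists_accuracy_bound`).
-/

/-! ### Autonomous differential equations -/

section Flow

variable {W : Type*} [NormedAddCommGroup W] [InnerProductSpace ℝ W]

/-- Decay along a trajectory as long as it stays in the region where `Y` is a strict Lyapunov
observable. -/
theorem norm_le_exp_of_lyapunov {X Y : W → W} {DY : W → W →L[ℝ] W} {w₀ : W} {R c : ℝ}
    (hY : ∀ w ∈ Metric.ball w₀ R, HasFDerivAt Y (DY w) w)
    (hdec : ∀ w ∈ Metric.ball w₀ R, inner ℝ (Y w) (DY w (X w)) ≤ -c * ‖Y w‖ ^ 2)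
    {w : ℝ → W} (hw : ∀ t ∈ Set.Ici (0 : ℝ), HasDerivWithinAt w (X (w t)) (Set.Ici 0) t)
    {T : ℝ} (hT : ∀ t ∈ Set.Ico 0 T, w t ∈ Metric.ball w₀ R) :
    ∀ t ∈ Set.Ico 0 T, ‖Y (w t)‖ ≤ Real.exp (-c * t) * ‖Y (w 0)‖ := by
  have hyd : ∀ t ∈ Set.Ico 0 T,
      HasDerivWithinAt (fun s => Y (w s)) (DY (w t) (X (w t))) (Set.Ici 0) t := fun t ht =>
    (hY _ (hT t ht)).comp_hasDerivWithinAt t (hw t ht.1)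
  have hh : ∀ t ∈ Set.Ico 0 T, HasDerivWithinAt
      (fun s => Real.exp (2 * c * s) * ‖Y (w s)‖ ^ 2)
      (Real.exp (2 * c * t) * (2 * c) * ‖Y (w t)‖ ^ 2 +
        Real.exp (2 * c * t) * (2 * inner ℝ (Y (w t)) (DY (w t) (X (w t))))) (Set.Ici 0) t := by
    intro t ht
    have h1 : HasDerivAt (fun s : ℝ => Real.exp (2 * c * s)) (Real.exp (2 * c * t) * (2 * c)) t := by
      simpa using ((hasDerivAt_id t).const_mul (2 * c)).exp
    exact h1.hasDerivWithinAt.mul (hyd t ht).norm_sq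
  have hanti : AntitoneOn (fun s => Real.exp (2 * c * s) * ‖Y (w s)‖ ^ 2) (Set.Ico 0 T) := by
    refine antitoneOn_of_hasDerivWithinAt_nonpos (convex_Ico 0 T) (fun t ht =>
      ((hh t ht).mono fun s hs => hs.1).continuousWithinAt)
      (f' := fun t => Real.exp (2 * c * t) * (2 * c) * ‖Y (w t)‖ ^ 2 +
        Real.exp (2 * c * t) * (2 * inner ℝ (Y (w t)) (DY (w t) (X (w t)))))
      (fun t ht => ?_) (fun t ht => ?_)
    · have ht' := interior_subset ht
      exact (hh t ht').mono fun s hs => (interior_subset hs).1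
    · have ht' := interior_subset ht
      have := hdec _ (hT t ht')
      have he := Real.exp_pos (2 * c * t)
      nlinarith
  intro t ht
  have h := hanti ⟨le_rfl, ht.1.trans_lt ht.2⟩ ht ht.1
  simp only [mul_zero, Real.exp_zero, one_mul] at h
  have e : Real.exp (2 * c * t) = Real.exp (c * t) ^ 2 := by
    rw [← Real.exp_nat_mul]; congr 1; push_cast; ring
  rw [e, ← mul_pow] at h
  have h2 := abs_le_of_sq_le_sq' h (norm_nonneg _)
  rw [neg_mul, Real.exp_neg, ← div_eq_inv_mul, le_div_iff₀ (Real.exp_pos _), mul_comm]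
  exact h2.2

variable [CompleteSpace W]

/-- A closed ball of a Hilbert space is a `1`-Lipschitz retract: the nearest-point map. -/
theorem exists_lipschitz_retraction_closedBall (c : W) {R : ℝ} (hR : 0 ≤ R) :
    ∃ π : W → W, LipschitzWith 1 π ∧ (∀ x, π x ∈ Metric.closedBall c R) ∧
      ∀ x ∈ Metric.closedBall c R, π x = x := by
  have hconv := convex_closedBall c R
  have hex := exists_norm_eq_iInf_of_complete_convex (K := Metric.closedBall c R)
    ⟨c, Metric.mem_closedBall_self hR⟩ Metric.isClosed_closedBall.isComplete hconv
  choose π hπ hmin using hex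
  have hin : ∀ x, ∀ y ∈ Metric.closedBall c R, inner ℝ (x - π x) (y - π x) ≤ 0 :=
    fun x => (norm_eq_iInf_iff_real_inner_le_zero hconv (hπ x)).1 (hmin x)
  refine ⟨π, LipschitzWith.of_dist_le_mul fun x y => ?_, hπ, fun x hx => ?_⟩
  · rw [dist_eq_norm, dist_eq_norm, NNReal.coe_one, one_mul]
    have h1 := hin x (π y) (hπ y)
    have h2 := hin y (π x) (hπ x)
    have h3 : ‖π x - π y‖ ^ 2 ≤ inner ℝ (x - y) (π x - π y) := by
      rw [← real_inner_self_eq_norm_sq]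
      have e : inner ℝ (x - y) (π x - π y) = inner ℝ (π x - π y) (π x - π y)
          - inner ℝ (x - π x) (π y - π x) - inner ℝ (y - π y) (π x - π y) := by
        simp only [inner_sub_left, inner_sub_right]; ring
      rw [e]; linarith
    have h4 := real_inner_le_norm (x - y) (π x - π y)
    by_contra! h
    nlinarith [norm_nonneg (π x - π y), norm_nonneg (x - y)]
  · have h := hin x x hx
    rw [real_inner_self_nonpos, sub_eq_zero] at h
    exact h.symm

/-- A bounded globally Lipschitz vector field has a solution for all positive times through each
point. -/
theorem exists_global_solution_of_bounded {X : W → W} {K : ℝ≥0} (hX : LipschitzWith K X) {B : ℝ}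
    (hB : ∀ w, ‖X w‖ ≤ B) (x : W) :
    ∃ w : ℝ → W, w 0 = x ∧
      ∀ t ∈ Set.Ici (0 : ℝ), HasDerivWithinAt w (X (w t)) (Set.Ici 0) t := by
  have hB0 : 0 ≤ B := (norm_nonneg _).trans (hB x)
  have hloc : ∀ n : ℕ, ∃ w : ℝ → W, w 0 = x ∧
      ∀ t ∈ Set.Icc (0 : ℝ) n, HasDerivWithinAt w (X (w t)) (Set.Icc 0 n) t := by
    intro n
    have hpl : IsPicardLindelof (fun _ => X) (tmin := 0) (tmax := n)
        ⟨0, le_rfl, n.cast_nonneg⟩ x (B * n).toNNReal 0 B.toNNReal K := by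
      refine IsPicardLindelof.of_time_independent (fun w _ => ?_) hX.lipschitzOnWith ?_
      · simpa [Real.coe_toNNReal _ hB0] using hB w
      · have : (0 : ℝ) ≤ n := n.cast_nonneg
        simp [Real.coe_toNNReal _ hB0, Real.coe_toNNReal _ (mul_nonneg hB0 this)]
    obtain ⟨w, hw0, hw⟩ := hpl.exists_eq_forall_mem_Icc_hasDerivWithinAt₀
    exact ⟨w, hw0, hw⟩
  choose u hu0 hu using hloc
  have hderiv : ∀ n : ℕ, ∀ t ∈ Set.Ico (0 : ℝ) n,
      HasDerivWithinAt (u n) (X (u n t)) (Set.Ici 0) t := fun n t ht =>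
    (hu n t ⟨ht.1, ht.2.le⟩).mono_of_mem_nhdsWithin
      (Filter.mem_of_superset (inter_mem_nhdsWithin _ (Iio_mem_nhds ht.2))
        fun s hs => ⟨hs.1, le_of_lt hs.2⟩)
  have hagree : ∀ m n : ℕ, m ≤ n → Set.EqOn (u m) (u n) (Set.Icc 0 m) := by
    intro m n hmn
    have hmn' : (m : ℝ) ≤ n := Nat.cast_le.2 hmn
    refine ODE_solution_unique_of_mem_Icc_right (v := fun _ => X) (s := fun _ => Set.univ) (K := K)
      (fun _ _ => hX.lipschitzOnWith) (fun t ht => (hu m t ht).continuousWithinAt)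
      (fun t ht => (hderiv m t ht).mono fun s hs => ht.1.trans hs) (fun _ _ => Set.mem_univ _)
      (fun t ht => ((hu n t ⟨ht.1, ht.2.trans hmn'⟩).mono
        (Set.Icc_subset_Icc_right hmn')).continuousWithinAt)
      (fun t ht => (hderiv n t ⟨ht.1, ht.2.trans_le hmn'⟩).mono fun s hs => ht.1.trans hs)
      (fun _ _ => Set.mem_univ _) ((hu0 m).trans (hu0 n).symm)
  refine ⟨fun t => u (⌈t⌉₊ + 1) t, hu0 _, fun t ht => ?_⟩
  have ht' : (0 : ℝ) ≤ t := ht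
  have heq : ∀ s : ℝ, 0 ≤ s → s ≤ (⌈t⌉₊ + 1 : ℕ) → u (⌈s⌉₊ + 1) s = u (⌈t⌉₊ + 1) s := by
    intro s hs hst
    have hs' : s ≤ (⌈s⌉₊ + 1 : ℕ) := by push_cast; linarith [Nat.le_ceil s]
    rcases le_total (⌈s⌉₊ + 1) (⌈t⌉₊ + 1) with h | h
    · exact hagree _ _ h ⟨hs, hs'⟩
    · exact (hagree _ _ h ⟨hs, hst⟩).symm
  have htn : t < (⌈t⌉₊ + 1 : ℕ) := by push_cast; linarith [Nat.le_ceil t]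
  have hd := hderiv (⌈t⌉₊ + 1) t ⟨ht', htn⟩
  refine hd.congr_of_eventuallyEq ?_ rfl
  filter_upwards [inter_mem_nhdsWithin (Set.Ici (0 : ℝ)) (Iio_mem_nhds htn)] with s hs
  exact heq s hs.1 (le_of_lt hs.2)

/-- A field that is Lipschitz on a closed ball agrees there with one all of whose trajectories
exist for all positive times. -/
theorem exists_global_solution_of_lipschitzOnWith {X : W → W} {K : ℝ≥0} {w₀ : W} {R : ℝ}
    (hR : 0 ≤ R) (hX : LipschitzOnWith K X (Metric.closedBall w₀ R)) :
    ∃ X' : W → W, Set.EqOn X' X (Metric.closedBall w₀ R) ∧ ∀ x, ∃ w : ℝ → W, w 0 = x ∧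
      ∀ t ∈ Set.Ici (0 : ℝ), HasDerivWithinAt w (X' (w t)) (Set.Ici 0) t := by
  obtain ⟨π, hπ, hπm, hπi⟩ := exists_lipschitz_retraction_closedBall w₀ hR
  refine ⟨fun w => X (π w), fun w hw => by simp [hπi w hw], fun x => ?_⟩
  refine exists_global_solution_of_bounded (X := fun w => X (π w)) (K := K * 1)
    (B := ‖X w₀‖ + K * R) ?_ (fun w => ?_) x
  · exact lipschitzOnWith_univ.1 (hX.comp hπ.lipschitzOnWith fun w _ => hπm w)
  · have h := hX.dist_le_mul _ (hπm w) _ (Metric.mem_closedBall_self hR)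
    rw [dist_eq_norm] at h
    have h2 : dist (π w) w₀ ≤ R := hπm w
    have h3 := norm_le_insert' (X (π w)) (X w₀)
    have h4 := mul_le_mul_of_nonneg_left h2 K.coe_nonneg
    linarith

/-- Trapping and exponential convergence: if `Y` decays exponentially along the field `X` and
dominates it, a trajectory whose a priori length `(D / c) ‖Y w₁‖` does not let it reach the
boundary of the ball stays in it and converges to a zero of `Y`. -/
theorem exists_limit_of_lyapunov {X Y : W → W} {DY : W → W →L[ℝ] W} {w₀ : W} {R c D : ℝ}
    (hc : 0 < c) (hD : 0 ≤ D)
    (hY : ∀ w ∈ Metric.ball w₀ R, HasFDerivAt Y (DY w) w)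
    (hdec : ∀ w ∈ Metric.ball w₀ R, inner ℝ (Y w) (DY w (X w)) ≤ -c * ‖Y w‖ ^ 2)
    (hX : ∀ w ∈ Metric.ball w₀ R, ‖X w‖ ≤ D * ‖Y w‖)
    {w : ℝ → W} (hw : ∀ t ∈ Set.Ici (0 : ℝ), HasDerivWithinAt w (X (w t)) (Set.Ici 0) t)
    (hw0 : ‖w 0 - w₀‖ + D / c * ‖Y (w 0)‖ < R) :
    (∀ t : ℝ, 0 ≤ t → w t ∈ Metric.ball w₀ R) ∧
    (∀ t : ℝ, 0 ≤ t → ‖Y (w t)‖ ≤ Real.exp (-c * t) * ‖Y (w 0)‖) ∧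
    ∃ wInf ∈ Metric.ball w₀ R, X wInf = 0 ∧ Y wInf = 0 ∧
      ∀ t : ℝ, 0 ≤ t → ‖w t - wInf‖ ≤ D / c * ‖Y (w 0)‖ * Real.exp (-c * t) := by
  have hcont : ContinuousOn w (Set.Ici 0) := fun t ht => (hw t ht).continuousWithinAt
  set A := D / c * ‖Y (w 0)‖ with hA
  have hA0 : 0 ≤ A := by positivity
  -- displacement estimate
  have hdisp : ∀ T : ℝ, (∀ t ∈ Set.Ico 0 T, w t ∈ Metric.ball w₀ R) → ∀ s, 0 ≤ s → s ≤ T →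
      ‖w T - w s‖ ≤ A * (Real.exp (-c * s) - Real.exp (-c * T)) := by
    intro T hT s hs hsT
    have hdecay := norm_le_exp_of_lyapunov hY hdec hw hT
    refine image_norm_le_of_norm_deriv_right_le_deriv_boundary (f := fun t => w t - w s)
      (a := s) (b := T) (f' := fun t => X (w t))
      (B := fun t => A * (Real.exp (-c * s) - Real.exp (-c * t)))
      (B' := fun t => A * (c * Real.exp (-c * t)))
      ((hcont.mono fun t ht => hs.trans ht.1).sub continuousOn_const)
      (fun t ht => ((hw t (hs.trans ht.1)).mono fun r hr =>
        (hs.trans ht.1).trans hr).sub_const _) (by simp) (fun t => ?_) (fun t ht => ?_) ⟨hsT, le_rfl⟩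
    · have h1 : HasDerivAt (fun t : ℝ => Real.exp (-c * t)) (Real.exp (-c * t) * (-c)) t := by
        simpa using ((hasDerivAt_id t).const_mul (-c)).exp
      convert! (h1.const_sub (Real.exp (-c * s))).const_mul A using 1
      ring
    · have ht' : t ∈ Set.Ico 0 T := ⟨hs.trans ht.1, ht.2⟩
      calc ‖X (w t)‖ ≤ D * ‖Y (w t)‖ := hX _ (hT t ht')
        _ ≤ D * (Real.exp (-c * t) * ‖Y (w 0)‖) := by gcongr; exact hdecay t ht'
        _ = A * (c * Real.exp (-c * t)) := by rw [hA]; field_simp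
  have hin : ∀ t : ℝ, 0 ≤ t → w t ∈ Metric.ball w₀ R := by
    by_contra! hcon
    obtain ⟨t₁, ht₁, hout⟩ := hcon
    set E := Set.Ici (0 : ℝ) ∩ (fun t => ‖w t - w₀‖) ⁻¹' Set.Ici R with hE
    have hEc : IsClosed E :=
      ((hcont.sub continuousOn_const).norm).preimage_isClosed_of_isClosed isClosed_Ici isClosed_Ici
    have hEn : E.Nonempty := ⟨t₁, ht₁, by simpa [dist_eq_norm] using hout⟩
    have hEb : BddBelow E := ⟨0, fun t ht => ht.1⟩
    have hTE := hEc.csInf_mem hEn hEb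
    set T := sInf E
    have hT : ∀ t ∈ Set.Ico 0 T, w t ∈ Metric.ball w₀ R := by
      intro t ht
      by_contra hn
      exact absurd (csInf_le hEb ⟨ht.1, by simpa [dist_eq_norm] using hn⟩) (not_le.2 ht.2)
    have h := hdisp T hT 0 le_rfl hTE.1
    have h2 : R ≤ ‖w T - w₀‖ := hTE.2
    have h3 : ‖w T - w₀‖ ≤ ‖w T - w 0‖ + ‖w 0 - w₀‖ := norm_sub_le_norm_sub_add_norm_sub _ _ _
    have h4 : A * (Real.exp (-c * 0) - Real.exp (-c * T)) ≤ A := by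
      have := Real.exp_pos (-c * T)
      simp only [mul_zero, Real.exp_zero]
      nlinarith
    linarith
  have hd : ∀ s t : ℝ, 0 ≤ s → s ≤ t → ‖w t - w s‖ ≤ A * Real.exp (-c * s) := by
    intro s t hs hst
    refine (hdisp t (fun r hr => hin r hr.1) s hs hst).trans ?_
    have := Real.exp_pos (-c * t)
    gcongr
    linarith
  have hdecay : ∀ t : ℝ, 0 ≤ t → ‖Y (w t)‖ ≤ Real.exp (-c * t) * ‖Y (w 0)‖ := fun t ht =>
    norm_le_exp_of_lyapunov hY hdec hw (T := t + 1) (fun r hr => hin r hr.1) t ⟨ht, by linarith⟩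
  refine ⟨hin, hdecay, ?_⟩
  have hlim0 : Tendsto (fun n : ℕ => Real.exp (-c * n)) atTop (𝓝 0) := by
    refine Real.tendsto_exp_atBot.comp ?_
    exact tendsto_natCast_atTop_atTop.const_mul_atTop_of_neg (by linarith)
  have hcau : CauchySeq fun n : ℕ => w n := by
    refine cauchySeq_of_le_tendsto_0' (fun n : ℕ => A * Real.exp (-c * n)) (fun n m hnm => ?_) ?_
    · rw [dist_comm, dist_eq_norm]
      exact hd n m n.cast_nonneg (Nat.cast_le.2 hnm)
    · simpa using hlim0.const_mul A
  obtain ⟨wInf, hwInf⟩ := cauchySeq_tendsto_of_complete hcau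
  have hrate : ∀ t : ℝ, 0 ≤ t → ‖w t - wInf‖ ≤ A * Real.exp (-c * t) := by
    intro t ht
    refine le_of_tendsto (tendsto_const_nhds.sub hwInf).norm ?_
    filter_upwards [eventually_ge_atTop ⌈t⌉₊] with n hn
    rw [norm_sub_rev]
    exact hd t n ht ((Nat.le_ceil t).trans (Nat.cast_le.2 hn))
  have hball : wInf ∈ Metric.ball w₀ R := by
    have h1 := hrate 0 le_rfl
    have h3 : ‖wInf - w₀‖ ≤ ‖wInf - w 0‖ + ‖w 0 - w₀‖ := norm_sub_le_norm_sub_add_norm_sub _ _ _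
    rw [norm_sub_rev] at h1
    simp only [mul_zero, Real.exp_zero, mul_one] at h1
    rw [Metric.mem_ball, dist_eq_norm]
    linarith
  have hYz : Y wInf = 0 := by
    have h1 : Tendsto (fun n : ℕ => ‖Y (w n)‖) atTop (𝓝 ‖Y wInf‖) :=
      ((hY _ hball).continuousAt.tendsto.comp hwInf).norm
    have h2 : Tendsto (fun n : ℕ => ‖Y (w n)‖) atTop (𝓝 0) := by
      refine squeeze_zero (fun _ => norm_nonneg _) (fun n : ℕ => hdecay n n.cast_nonneg) ?_
      simpa using hlim0.mul_const ‖Y (w 0)‖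
    exact norm_eq_zero.1 (tendsto_nhds_unique h1 h2)
  refine ⟨wInf, hball, ?_, hYz, hrate⟩
  have := hX _ hball
  rw [hYz, norm_zero, mul_zero] at this
  exact norm_le_zero_iff.1 this

end Flow

/-! ### Models of locally constant rank -/

section Chart

variable {W H : Type*} [NormedAddCommGroup W] [InnerProductSpace ℝ W] [FiniteDimensional ℝ W]
  [NormedAddCommGroup H] [InnerProductSpace ℝ H]

/-- A normal form of a model `V` of locally constant rank with `V w₀ = 0`: near `w₀` it factors
as `V = g ∘ Φ` through a local chart `Φ` of the parameter space centred at `w₀`, and `g` depends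
only on the orthogonal projection `P z` of the chart coordinate `z`. Here `J` is the derivative of
`g`, `A` that of `Φ`, and the linear map `ℓ` reads the coordinate `P z` off the value `g z`. -/
structure RankChart (V : W → H) (w₀ : W) where
  /-- the orthogonal projection onto the coordinates seen by the model -/
  P : W →L[ℝ] W
  /-- the linear read-out of these coordinates -/
  ℓ : H →L[ℝ] W
  /-- the chart -/
  Φ : W → W
  /-- the derivative of the chart -/
  A : W → W →L[ℝ] W
  /-- the model in the chart -/
  g : W → H
  /-- the derivative of the model in the chart -/
  J : W → W →L[ℝ] H
  /-- the radius of the domain of the chart -/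
  R : ℝ
  /-- the radius of the domain of `g` -/
  δ : ℝ
  /-- a constant for all the bounds -/
  C : ℝ
  R_pos : 0 < R
  δ_pos : 0 < δ
  C_pos : 0 < C
  P_idem : ∀ x, P (P x) = P x
  P_symm : ∀ x y, inner ℝ (P x) y = inner ℝ x (P y)
  norm_P_le : ∀ x, ‖P x‖ ≤ ‖x‖
  P_ℓ : ∀ v, P (ℓ v) = ℓ v
  Φ_mem : ∀ w ∈ Metric.ball w₀ R, Φ w ∈ Metric.ball 0 δ
  norm_Φ_le : ∀ w ∈ Metric.ball w₀ R, ‖Φ w‖ ≤ C * ‖w - w₀‖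
  V_eq : ∀ w ∈ Metric.ball w₀ R, V w = g (Φ w)
  P_Φ : ∀ w, P (Φ w) = ℓ (V w)
  fderiv_eq : ∀ w ∈ Metric.ball w₀ R, fderiv ℝ V w = (J (Φ w)).comp (A w)
  ℓ_fderiv : ∀ w, ℓ.comp (fderiv ℝ V w) = P.comp (A w)
  norm_A_sub_le : ∀ w, ‖A w - ContinuousLinearMap.id ℝ W‖ ≤ C * ‖w - w₀‖
  J_P : ∀ z ∈ Metric.ball 0 δ, ∀ x, J z (P x) = J z x
  J_lipschitz : ∀ z ∈ Metric.ball 0 δ, ∀ z' ∈ Metric.ball 0 δ, ‖J z - J z'‖ ≤ C * ‖P (z - z')‖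
  g_approx : ∀ s ≤ δ, ∀ z ∈ Metric.ball 0 s, ∀ z' ∈ Metric.ball 0 s,
    ‖g z - g z' - J 0 (z - z')‖ ≤ C * s * ‖P (z - z')‖

/-- The pseudo-inverse `ℓ` of a linear map `D` on a finite-dimensional space: `ℓ ∘ D` is the
orthogonal projection `P` onto the complement of the kernel of `D`. -/
theorem exists_pseudoInverse (D : W →L[ℝ] H) :
    ∃ (P : W →L[ℝ] W) (ℓ : H →L[ℝ] W), (∀ x, P (P x) = P x) ∧
      (∀ x y, inner ℝ (P x) y = inner ℝ x (P y)) ∧ (∀ x, ‖P x‖ ≤ ‖x‖) ∧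
      (∀ v, P (ℓ v) = ℓ v) ∧ (∀ x, ℓ (D x) = P x) ∧
      LinearMap.ker (P : W →ₗ[ℝ] W) = LinearMap.ker (D : W →ₗ[ℝ] H) := by
  set N : Submodule ℝ W := LinearMap.ker (D : W →ₗ[ℝ] H)
  have hsub : ∀ x, D (Nᗮ.starProjection x) = D x := by
    intro x
    have h := Nᗮ.sub_starProjection_mem_orthogonal x
    rw [Submodule.orthogonal_orthogonal] at h
    have h2 : D (x - Nᗮ.starProjection x) = 0 := h
    rw [map_sub, sub_eq_zero] at h2
    exact h2.symm
  let D' : Nᗮ →ₗ[ℝ] H := (D : W →ₗ[ℝ] H) ∘ₗ Nᗮ.subtype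
  have hinj : Function.Injective D' := by
    rw [← LinearMap.ker_eq_bot, LinearMap.ker_eq_bot']
    intro x hx
    have h1 : (x : W) ∈ N := hx
    have h2 : inner ℝ (x : W) (x : W) = 0 := x.2 _ h1
    exact Subtype.ext (inner_self_eq_zero.1 h2)
  let e := LinearEquiv.ofInjective D' hinj
  let T : Submodule ℝ H := LinearMap.range D'
  let ℓ : H →L[ℝ] W := Nᗮ.subtypeL ∘L
    (LinearMap.toContinuousLinearMap (e.symm : T →ₗ[ℝ] Nᗮ)) ∘L T.orthogonalProjectionOnto
  have hℓ : ∀ x, ℓ (D x) = Nᗮ.starProjection x := by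
    intro x
    have h1 : D x = ((e (Nᗮ.orthogonalProjectionOnto x) : T) : H) := (hsub x).symm
    have h2 : T.orthogonalProjectionOnto (D x) = e (Nᗮ.orthogonalProjectionOnto x) := by
      rw [h1, Submodule.orthogonalProjectionOnto_mem_subspace_eq_self]
    change ((e.symm (T.orthogonalProjectionOnto (D x)) : Nᗮ) : W) = _
    rw [h2, LinearEquiv.symm_apply_apply]
    rfl
  refine ⟨Nᗮ.starProjection, ℓ, fun x => ?_, fun x y => ?_, fun x => ?_, fun v => ?_, hℓ, ?_⟩
  · exact Submodule.starProjection_eq_self_iff.2 (Submodule.starProjection_apply_mem _ _)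
  · exact Submodule.inner_starProjection_left_eq_right _ _ _
  · exact Submodule.norm_starProjection_apply_le _ _
  · exact Submodule.starProjection_eq_self_iff.2 (Subtype.coe_prop _)
  · ext x
    simp only [LinearMap.mem_ker, ContinuousLinearMap.coe_coe]
    constructor
    · intro h
      change D x = 0
      rw [← hsub x, h, map_zero]
    · intro h
      have h' : D x = 0 := h
      rw [← hℓ x, h', map_zero]

/-- A linear map `k` that does not lower the rank of `f` is injective on the range of `f`. -/
theorem apply_eq_zero_of_finrank_range_comp_eq {f : W →ₗ[ℝ] H} {k : H →ₗ[ℝ] W}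
    (h : Module.finrank ℝ (LinearMap.range (k ∘ₗ f)) = Module.finrank ℝ (LinearMap.range f))
    {u : W} (hu : k (f u) = 0) : f u = 0 := by
  have h1 := LinearMap.finrank_range_add_finrank_ker f
  have h2 := LinearMap.finrank_range_add_finrank_ker (k ∘ₗ f)
  have h3 : LinearMap.ker f = LinearMap.ker (k ∘ₗ f) :=
    Submodule.eq_of_le_of_finrank_eq (LinearMap.ker_le_ker_comp f k) (by omega)
  have h4 : u ∈ LinearMap.ker (k ∘ₗ f) := hu
  rw [← h3] at h4
  exact h4

/-- Close to the identity the inverse of a linear map exists and is bounded by `2`. -/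
theorem exists_inverse_of_norm_sub_id_le (A : W →L[ℝ] W)
    (hA : ‖A - ContinuousLinearMap.id ℝ W‖ ≤ 1 / 2) :
    ∃ B : W →L[ℝ] W, A.comp B = ContinuousLinearMap.id ℝ W ∧
      B.comp A = ContinuousLinearMap.id ℝ W ∧ ‖B‖ ≤ 2 := by
  have : CompleteSpace W := FiniteDimensional.complete ℝ W
  have hu : IsUnit A := by
    have h := isUnit_one_sub_of_norm_lt_one (x := ContinuousLinearMap.id ℝ W - A)
      (by rw [norm_sub_rev]; linarith)
    rwa [ContinuousLinearMap.one_def, sub_sub_cancel] at h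
  obtain ⟨⟨A, B, h1, h2⟩, rfl⟩ := hu
  refine ⟨B, h1, h2, ?_⟩
  have e : B = ContinuousLinearMap.id ℝ W - (A - ContinuousLinearMap.id ℝ W) * B := by
    rw [sub_mul, h1, ← ContinuousLinearMap.one_def, one_mul]; abel
  have h3 : ‖B‖ ≤ 1 + 1 / 2 * ‖B‖ := by
    calc ‖B‖ = ‖ContinuousLinearMap.id ℝ W - (A - ContinuousLinearMap.id ℝ W) * B‖ := by rw [← e]
      _ ≤ ‖ContinuousLinearMap.id ℝ W‖ + ‖(A - ContinuousLinearMap.id ℝ W) * B‖ := norm_sub_le _ _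
      _ ≤ 1 + 1 / 2 * ‖B‖ := by
        refine add_le_add ContinuousLinearMap.norm_id_le ((norm_mul_le _ _).trans ?_)
        exact mul_le_mul_of_nonneg_right hA (norm_nonneg _)
  linarith

/-- Constant rank theorem with Lipschitz derivatives. The chart is
`Φ w = ℓ (V w) + (1 - P) (w - w₀)`, whose derivative at `w₀` is the identity. Constancy of the
rank makes `ℓ` injective on the range of `DV_w`, so that `g = V ∘ Φ⁻¹` has zero derivative in the
directions killed by `P`. -/
theorem exists_rankChart {V : W → H} (hV : Differentiable ℝ V) {L : ℝ≥0}
    (hDV : LipschitzWith L (fderiv ℝ V)) {w₀ : W} {r : ℕ}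
    (hrank : ∀ᶠ w in 𝓝 w₀,
      Module.finrank ℝ (LinearMap.range (fderiv ℝ V w : W →ₗ[ℝ] H)) = r) (hV0 : V w₀ = 0) :
    Nonempty (RankChart V w₀) := by
  have : CompleteSpace W := FiniteDimensional.complete ℝ W
  obtain ⟨P, ℓ, hPi, hPs, hPn, hPℓ, hℓD, hker⟩ := exists_pseudoInverse (fderiv ℝ V w₀)
  set I := ContinuousLinearMap.id ℝ W with hI
  set A : W → W →L[ℝ] W := fun w => ℓ.comp (fderiv ℝ V w) + (I - P) with hA
  set Φ : W → W := fun w => ℓ (V w) + (I - P) (w - w₀) with hΦ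
  set a : ℝ := ‖ℓ‖ * L with ha
  have ha0 : 0 ≤ a := by positivity
  have hDVn : ∀ w w', ‖fderiv ℝ V w - fderiv ℝ V w'‖ ≤ L * ‖w - w'‖ := fun w w' => by
    simpa [dist_eq_norm] using hDV.dist_le_mul w w'
  have hA0 : A w₀ = I := by
    ext x : 1
    simp [hA, hI, hℓD]
  have hAlip : ∀ w w', ‖A w - A w'‖ ≤ a * ‖w - w'‖ := by
    intro w w'
    have : A w - A w' = ℓ.comp (fderiv ℝ V w - fderiv ℝ V w') := by
      simp [hA, ContinuousLinearMap.comp_sub]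
    rw [this]
    refine (ContinuousLinearMap.opNorm_comp_le _ _).trans ?_
    rw [ha, mul_assoc]
    exact mul_le_mul_of_nonneg_left (hDVn _ _) (norm_nonneg _)
  have hAI : ∀ w, ‖A w - I‖ ≤ a * ‖w - w₀‖ := fun w => by rw [← hA0]; exact hAlip _ _
  have hΦd : ∀ w, HasFDerivAt Φ (A w) w := fun w => by
    refine (ℓ.hasFDerivAt.comp w (hV w).hasFDerivAt).add ?_
    exact (I - P).hasFDerivAt.comp w ((hasFDerivAt_id w).sub_const w₀)
  have hΦ0 : Φ w₀ = 0 := by simp [hΦ, hV0]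
  have hPA : ∀ w, ℓ.comp (fderiv ℝ V w) = P.comp (A w) := fun w => by
    ext x : 1
    simp [hA, hI, hPℓ, hPi]
  have hPΦ : ∀ w, P (Φ w) = ℓ (V w) := fun w => by
    simp [hΦ, hI, hPℓ, hPi]
  -- the radius of the chart
  obtain ⟨R₁, hR₁, hrk⟩ := Metric.eventually_nhds_iff_ball.1 hrank
  set R := min R₁ (1 / (2 * (a + 1))) with hR
  have hRpos : 0 < R := lt_min hR₁ (by positivity)
  have haR : a * R ≤ 1 / 2 := by
    have h1 : R ≤ 1 / (2 * (a + 1)) := min_le_right _ _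
    rw [le_div_iff₀ (by positivity)] at h1
    nlinarith
  have hAhalf : ∀ w ∈ Metric.ball w₀ R, ‖A w - I‖ ≤ 1 / 2 := fun w hw => by
    rw [Metric.mem_ball, dist_eq_norm] at hw
    exact (hAI w).trans ((mul_le_mul_of_nonneg_left hw.le ha0).trans haR)
  have hinv : ∀ w, ∃ B : W →L[ℝ] W, w ∈ Metric.ball w₀ R → (A w).comp B = I ∧
      B.comp (A w) = I ∧ ‖B‖ ≤ 2 := fun w => by
    by_cases hw : w ∈ Metric.ball w₀ R
    · obtain ⟨B, hB⟩ := exists_inverse_of_norm_sub_id_le (A w) (hAhalf w hw)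
      exact ⟨B, fun _ => hB⟩
    · exact ⟨0, fun h => absurd h hw⟩
  choose B hB using hinv
  have hBlip : ∀ w ∈ Metric.ball w₀ R, ∀ w' ∈ Metric.ball w₀ R,
      ‖B w - B w'‖ ≤ 4 * a * ‖w - w'‖ := by
    intro w hw w' hw'
    have e : B w - B w' = (B w).comp ((A w' - A w).comp (B w')) := by
      rw [ContinuousLinearMap.sub_comp, ContinuousLinearMap.comp_sub, (hB w' hw').1,
        ← ContinuousLinearMap.comp_assoc, (hB w hw).2.1]
      simp [hI]
    rw [e]
    refine (ContinuousLinearMap.opNorm_comp_le _ _).trans ?_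
    calc ‖B w‖ * ‖(A w' - A w).comp (B w')‖ ≤ 2 * (a * ‖w' - w‖ * 2) := by
          refine mul_le_mul (hB w hw).2.2 ((ContinuousLinearMap.opNorm_comp_le _ _).trans ?_)
            (norm_nonneg _) (by norm_num)
          exact mul_le_mul (hAlip _ _) (hB w' hw').2.2 (norm_nonneg _) (by positivity)
      _ = 4 * a * ‖w - w'‖ := by rw [norm_sub_rev]; ring
  -- the local inverse of the chart
  have happ : ∀ w ∈ Metric.ball w₀ R, ∀ w' ∈ Metric.ball w₀ R,
      ‖Φ w - Φ w' - (w - w')‖ ≤ 1 / 2 * ‖w - w'‖ := by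
    intro w hw w' hw'
    exact (convex_ball w₀ R).norm_image_sub_le_of_norm_hasFDerivWithin_le' (φ := I)
      (fun x _ => (hΦd x).hasFDerivWithinAt) hAhalf hw' hw
  have hal : ApproximatesLinearOn Φ ((ContinuousLinearEquiv.refl ℝ W : W ≃L[ℝ] W) : W →L[ℝ] W)
      (Metric.ball w₀ R) (1 / 2) := fun w hw w' hw' => by
    simpa using happ w hw w' hw'
  have hcond : Subsingleton W ∨
      (1 / 2 : ℝ≥0) < ‖((ContinuousLinearEquiv.refl ℝ W).symm : W →L[ℝ] W)‖₊⁻¹ := by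
    rcases subsingleton_or_nontrivial W with h | h
    · exact Or.inl h
    · right
      have : ‖((ContinuousLinearEquiv.refl ℝ W).symm : W →L[ℝ] W)‖₊ = 1 := by
        apply NNReal.eq
        exact ContinuousLinearMap.norm_id
      rw [this, inv_one]
      exact NNReal.half_lt_self one_ne_zero
  set φ := hal.toOpenPartialHomeomorph Φ (Metric.ball w₀ R) hcond Metric.isOpen_ball with hφ
  have hφc : ∀ w, φ w = Φ w := fun _ => rfl
  have hw₀ : w₀ ∈ φ.source := Metric.mem_ball_self hRpos
  have h0t : (0 : W) ∈ φ.target := by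
    have := φ.map_source hw₀
    rwa [hφc, hΦ0] at this
  obtain ⟨δ, hδ, hδt⟩ := Metric.isOpen_iff.1 φ.open_target 0 h0t
  set ψ : W → W := fun z => φ.symm z with hψ
  have hψm : ∀ z ∈ Metric.ball (0 : W) δ, ψ z ∈ Metric.ball w₀ R := fun z hz =>
    φ.map_target (hδt hz)
  have hΦψ : ∀ z ∈ Metric.ball (0 : W) δ, Φ (ψ z) = z := fun z hz => φ.right_inv (hδt hz)
  have hψΦ : ∀ w ∈ Metric.ball w₀ R, ψ (Φ w) = w := fun w hw => φ.left_inv hw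
  have hψlip : ∀ z ∈ Metric.ball (0 : W) δ, ∀ z' ∈ Metric.ball (0 : W) δ,
      ‖ψ z - ψ z'‖ ≤ 2 * ‖z - z'‖ := by
    intro z hz z' hz'
    have h := happ _ (hψm z hz) _ (hψm z' hz')
    rw [hΦψ z hz, hΦψ z' hz', norm_sub_rev] at h
    have h2 := norm_le_insert' (ψ z - ψ z') (z - z')
    linarith
  have hψd : ∀ z ∈ Metric.ball (0 : W) δ, HasFDerivAt ψ (B (ψ z)) z := by
    intro z hz
    have hb := hB _ (hψm z hz)
    let e : W ≃L[ℝ] W := ContinuousLinearEquiv.equivOfInverse (A (ψ z)) (B (ψ z))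
      (fun x => DFunLike.congr_fun hb.2.1 x) (fun x => DFunLike.congr_fun hb.1 x)
    exact φ.hasFDerivAt_symm (f' := e) (hδt hz) (hΦd (ψ z))
  -- the model in the chart
  set g : W → H := fun z => V (ψ z) with hg
  set J : W → W →L[ℝ] H := fun z => (fderiv ℝ V (ψ z)).comp (B (ψ z)) with hJ
  have hgd : ∀ z ∈ Metric.ball (0 : W) δ, HasFDerivAt g (J z) z := fun z hz =>
    (hV (ψ z)).hasFDerivAt.comp z (hψd z hz)
  have hJP : ∀ z ∈ Metric.ball (0 : W) δ, ∀ x, J z (P x) = J z x := by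
    intro z hz x
    have hb := hB _ (hψm z hz)
    set w := ψ z
    have hsurj : LinearMap.range (A w : W →ₗ[ℝ] W) = ⊤ := by
      rw [LinearMap.range_eq_top]
      exact fun y => ⟨B w y, DFunLike.congr_fun hb.1 y⟩
    have hcomp : (ℓ : H →ₗ[ℝ] W) ∘ₗ (fderiv ℝ V w : W →ₗ[ℝ] H) =
        (P : W →ₗ[ℝ] W) ∘ₗ (A w : W →ₗ[ℝ] W) := by
      ext y
      exact DFunLike.congr_fun (hPA w) y
    have hr1 := hrk w (Metric.ball_subset_ball (min_le_left _ _) (hψm z hz))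
    have hr0 := hrk w₀ (Metric.mem_ball_self hR₁)
    have hrP : Module.finrank ℝ (LinearMap.range (P : W →ₗ[ℝ] W)) = r := by
      have h1 := LinearMap.finrank_range_add_finrank_ker (P : W →ₗ[ℝ] W)
      have h2 := LinearMap.finrank_range_add_finrank_ker (fderiv ℝ V w₀ : W →ₗ[ℝ] H)
      rw [hker] at h1
      omega
    have hz0 : fderiv ℝ V w (B w (x - P x)) = 0 := by
      refine apply_eq_zero_of_finrank_range_comp_eq (f := (fderiv ℝ V w : W →ₗ[ℝ] H))
        (k := (ℓ : H →ₗ[ℝ] W)) ?_ ?_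
      · rw [hcomp, LinearMap.range_comp_of_range_eq_top _ hsurj, hrP, hr1]
      · have h1 : ℓ (fderiv ℝ V w (B w (x - P x))) = P (A w (B w (x - P x))) :=
          DFunLike.congr_fun (hPA w) _
        have h2 : A w (B w (x - P x)) = x - P x := DFunLike.congr_fun hb.1 _
        have h3 : P (x - P x) = 0 := by rw [map_sub, hPi, sub_self]
        rw [h2, h3] at h1
        exact h1
    have h3 : J z (x - P x) = 0 := hz0
    rw [map_sub, sub_eq_zero] at h3
    exact h3.symm
  set b : ℝ := ‖fderiv ℝ V w₀‖ + L * R with hb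
  have hb0 : 0 ≤ b := by positivity
  have hDVb : ∀ w ∈ Metric.ball w₀ R, ‖fderiv ℝ V w‖ ≤ b := by
    intro w hw
    rw [Metric.mem_ball, dist_eq_norm] at hw
    have h1 := norm_le_insert' (fderiv ℝ V w) (fderiv ℝ V w₀)
    have h2 := (hDVn w w₀).trans (mul_le_mul_of_nonneg_left hw.le L.coe_nonneg)
    linarith
  set C : ℝ := 2 + a + (2 * L + b * (4 * a)) * 2 with hC
  have hJlip : ∀ z ∈ Metric.ball (0 : W) δ, ∀ z' ∈ Metric.ball (0 : W) δ,
      ‖J z - J z'‖ ≤ C * ‖z - z'‖ := by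
    intro z hz z' hz'
    have e : J z - J z' = (fderiv ℝ V (ψ z) - fderiv ℝ V (ψ z')).comp (B (ψ z)) +
        (fderiv ℝ V (ψ z')).comp (B (ψ z) - B (ψ z')) := by
      simp [hJ, ContinuousLinearMap.comp_sub, ContinuousLinearMap.sub_comp]
    have h1 : ‖(fderiv ℝ V (ψ z) - fderiv ℝ V (ψ z')).comp (B (ψ z))‖ ≤
        L * ‖ψ z - ψ z'‖ * 2 :=
      (ContinuousLinearMap.opNorm_comp_le _ _).trans
        (mul_le_mul (hDVn _ _) (hB _ (hψm z hz)).2.2 (norm_nonneg _) (by positivity))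
    have h2 : ‖(fderiv ℝ V (ψ z')).comp (B (ψ z) - B (ψ z'))‖ ≤ b * (4 * a * ‖ψ z - ψ z'‖) :=
      (ContinuousLinearMap.opNorm_comp_le _ _).trans
        (mul_le_mul (hDVb _ (hψm z' hz')) (hBlip _ (hψm z hz) _ (hψm z' hz')) (norm_nonneg _) hb0)
    rw [e]
    calc _ ≤ L * ‖ψ z - ψ z'‖ * 2 + b * (4 * a * ‖ψ z - ψ z'‖) :=
          (norm_add_le _ _).trans (add_le_add h1 h2)
      _ = (2 * L + b * (4 * a)) * ‖ψ z - ψ z'‖ := by ring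
      _ ≤ (2 * L + b * (4 * a)) * (2 * ‖z - z'‖) :=
          mul_le_mul_of_nonneg_left (hψlip z hz z' hz') (by positivity)
      _ ≤ C * ‖z - z'‖ := by
          rw [hC]
          nlinarith [norm_nonneg (z - z')]
  have hPm : ∀ s : ℝ, ∀ z ∈ Metric.ball (0 : W) s, P z ∈ Metric.ball (0 : W) s := fun s z hz => by
    rw [mem_ball_zero_iff] at hz ⊢
    exact (hPn z).trans_lt hz
  have hgP : ∀ z ∈ Metric.ball (0 : W) δ, g z = g (P z) := by
    intro z hz
    have hseg : ∀ t ∈ Set.Icc (0 : ℝ) 1, P z + t • (z - P z) ∈ Metric.ball (0 : W) δ := fun t ht =>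
      (convex_ball (0 : W) δ).add_smul_sub_mem (hPm δ z hz) hz ht
    have hder : ∀ t ∈ Set.Icc (0 : ℝ) 1,
        HasDerivAt (fun t : ℝ => g (P z + t • (z - P z))) 0 t := by
      intro t ht
      have h1 : HasDerivAt (fun t : ℝ => P z + t • (z - P z)) (z - P z) t := by
        simpa using ((hasDerivAt_id t).smul_const (z - P z)).const_add (P z)
      have h2 := (hgd _ (hseg t ht)).comp_hasDerivAt t h1
      rwa [← hJP _ (hseg t ht), map_sub, hPi, sub_self, map_zero] at h2
    have h := constant_of_has_deriv_right_zero
      (fun t ht => (hder t ht).continuousAt.continuousWithinAt)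
      (fun t ht => (hder t ⟨ht.1, ht.2.le⟩).hasDerivWithinAt) 1 ⟨zero_le_one, le_rfl⟩
    simpa using h
  have hJJP : ∀ z ∈ Metric.ball (0 : W) δ, J z = J (P z) := by
    intro z hz
    have h1 : HasFDerivAt (fun z => g (P z)) ((J (P z)).comp P) z :=
      (hgd _ (hPm δ z hz)).comp z P.hasFDerivAt
    have h2 : (fun z => g (P z)) =ᶠ[𝓝 z] g := by
      filter_upwards [Metric.isOpen_ball.mem_nhds hz] with y hy
      exact (hgP y hy).symm
    have h3 := (hgd z hz).unique (h1.congr_of_eventuallyEq h2.symm)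
    rw [h3]
    ext x : 1
    exact hJP _ (hPm δ z hz) x
  have hR' : min R (δ / 2) ≤ R := min_le_left _ _
  have hΦn : ∀ w ∈ Metric.ball w₀ R, ‖Φ w‖ ≤ 3 / 2 * ‖w - w₀‖ := by
    intro w hw
    have h := happ w hw w₀ hw₀
    rw [hΦ0, sub_zero] at h
    have h2 := norm_le_insert' (Φ w) (w - w₀)
    linarith
  have hC2 : 2 + a ≤ C := by
    have : 0 ≤ (2 * L + b * (4 * a)) * 2 := by positivity
    linarith
  refine ⟨{ P := P, ℓ := ℓ, Φ := Φ, A := A, g := g, J := J, R := min R (δ / 2), δ := δ, C := C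
            R_pos := lt_min hRpos (by positivity)
            δ_pos := hδ
            C_pos := by linarith
            P_idem := hPi
            P_symm := hPs
            norm_P_le := hPn
            P_ℓ := hPℓ
            Φ_mem := fun w hw => ?_
            norm_Φ_le := fun w hw => ?_
            V_eq := fun w hw => ?_
            P_Φ := hPΦ
            fderiv_eq := fun w hw => ?_
            ℓ_fderiv := hPA
            norm_A_sub_le := fun w => ?_
            J_P := hJP
            J_lipschitz := fun z hz z' hz' => ?_
            g_approx := fun s hs z hz z' hz' => ?_ }⟩
  · have h1 := hΦn w (Metric.ball_subset_ball hR' hw)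
    have h2 : ‖w - w₀‖ < δ / 2 := by
      rw [Metric.mem_ball, dist_eq_norm] at hw
      exact hw.trans_le (min_le_right _ _)
    rw [mem_ball_zero_iff]
    linarith
  · refine (hΦn w (Metric.ball_subset_ball hR' hw)).trans ?_
    gcongr
    linarith
  · simp [hg, hψΦ w (Metric.ball_subset_ball hR' hw)]
  · have hw' := Metric.ball_subset_ball hR' hw
    simp only [hJ, hψΦ w hw']
    rw [ContinuousLinearMap.comp_assoc, (hB w hw').2.1]
    simp [hI]
  · refine (hAI w).trans ?_
    gcongr
    linarith
  · rw [hJJP z hz, hJJP z' hz', map_sub]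
    exact hJlip _ (hPm δ z hz) _ (hPm δ z' hz')
  · have hsub := Metric.ball_subset_ball (x := (0 : W)) hs
    have h0 : (0 : W) ∈ Metric.ball (0 : W) δ := Metric.mem_ball_self hδ
    rw [hgP z (hsub hz), hgP z' (hsub hz'), ← hJP 0 h0, map_sub P]
    refine (convex_ball (0 : W) s).norm_image_sub_le_of_norm_hasFDerivWithin_le' (φ := J 0)
      (fun x hx => (hgd x (hsub hx)).hasFDerivWithinAt) (fun x hx => ?_) (hPm s z' hz') (hPm s z hz)
    have h1 := hJlip x (hsub hx) 0 h0
    rw [mem_ball_zero_iff] at hx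
    rw [sub_zero] at h1
    exact h1.trans (by gcongr)

end Chart

/-! ### Zeros of strongly monotone maps -/

section Monotone

variable {W : Type*} [NormedAddCommGroup W] [InnerProductSpace ℝ W] [CompleteSpace W]

/-- A strongly monotone Lipschitz map on a ball whose value at the centre is small has a zero: it
is the fixed point of the contraction `z ↦ z - (m / K²) F z`. -/
theorem exists_zero_of_stronglyMonotone {F : W → W} {m K s : ℝ} (hm : 0 < m) (hmK : m ≤ K)
    (hs : 0 ≤ s)
    (hmono : ∀ z ∈ Metric.closedBall (0 : W) s, ∀ z' ∈ Metric.closedBall (0 : W) s,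
      m * ‖z - z'‖ ^ 2 ≤ inner ℝ (F z - F z') (z - z'))
    (hlip : ∀ z ∈ Metric.closedBall (0 : W) s, ∀ z' ∈ Metric.closedBall (0 : W) s,
      ‖F z - F z'‖ ≤ K * ‖z - z'‖)
    (h0 : ‖F 0‖ ≤ m * s / 2) :
    ∃ z ∈ Metric.closedBall (0 : W) s, F z = 0 := by
  have hK : 0 < K := hm.trans_le hmK
  set η := m / K ^ 2 with hη
  have hη0 : 0 < η := by positivity
  set q := 1 - η * m / 2 with hq
  have hηm : η * m ≤ 1 := by
    rw [hη, div_mul_eq_mul_div, div_le_one (by positivity)]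
    nlinarith
  have hq0 : 0 ≤ q := by rw [hq]; linarith
  have hq1 : q < 1 := by rw [hq]; have := mul_pos hη0 hm; linarith
  set G : W → W := fun z => z - η • F z with hG
  have hGl : ∀ z ∈ Metric.closedBall (0 : W) s, ∀ z' ∈ Metric.closedBall (0 : W) s,
      ‖G z - G z'‖ ≤ q * ‖z - z'‖ := by
    intro z hz z' hz'
    have e : G z - G z' = (z - z') - η • (F z - F z') := by
      simp only [hG, smul_sub]; abel
    have h1 := hmono z hz z' hz'
    have h2 := hlip z hz z' hz'
    have h3 : ‖G z - G z'‖ ^ 2 ≤ (q * ‖z - z'‖) ^ 2 := by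
      rw [e, norm_sub_sq_real, inner_smul_right, norm_smul, Real.norm_of_nonneg hη0.le,
        real_inner_comm]
      have h4 : ‖F z - F z'‖ ^ 2 ≤ K ^ 2 * ‖z - z'‖ ^ 2 := by
        rw [← mul_pow]; exact pow_le_pow_left₀ (norm_nonneg _) h2 2
      have h5 : η ^ 2 * ‖F z - F z'‖ ^ 2 ≤ η * m * ‖z - z'‖ ^ 2 := by
        calc η ^ 2 * ‖F z - F z'‖ ^ 2 ≤ η ^ 2 * (K ^ 2 * ‖z - z'‖ ^ 2) := by gcongr
          _ = η * m * ‖z - z'‖ ^ 2 := by rw [hη]; field_simp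
      have h6 := mul_le_mul_of_nonneg_left h1 hη0.le
      have h7 : (q * ‖z - z'‖) ^ 2 =
          ‖z - z'‖ ^ 2 - η * m * ‖z - z'‖ ^ 2 + (η * m / 2 * ‖z - z'‖) ^ 2 := by
        rw [hq]; ring
      have h8 := sq_nonneg (η * m / 2 * ‖z - z'‖)
      rw [h7, mul_pow]
      linarith
    exact le_of_sq_le_sq h3 (by positivity)
  have h0m : (0 : W) ∈ Metric.closedBall (0 : W) s := Metric.mem_closedBall_self hs
  have hmaps : Set.MapsTo G (Metric.closedBall (0 : W) s) (Metric.closedBall (0 : W) s) := by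
    intro z hz
    have h1 := hGl z hz 0 h0m
    have h2 : ‖G 0‖ ≤ η * (m * s / 2) := by
      simp only [hG, zero_sub, norm_neg, norm_smul, Real.norm_of_nonneg hη0.le]
      gcongr
    have h3 := norm_le_insert' (G z) (G 0)
    rw [mem_closedBall_zero_iff] at hz ⊢
    rw [sub_zero] at h1
    have h4 := mul_le_mul_of_nonneg_left hz hq0
    have h5 : q * s + η * (m * s / 2) = s := by rw [hq]; ring
    linarith
  have hcontr : ContractingWith ⟨q, hq0⟩ (hmaps.restrict G _ _) := by
    refine ⟨by exact_mod_cast hq1, LipschitzWith.of_dist_le_mul fun x y => ?_⟩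
    rw [Subtype.dist_eq, Subtype.dist_eq, dist_eq_norm, dist_eq_norm]
    exact hGl x x.2 y y.2
  obtain ⟨z, hz, hfix, -⟩ := hcontr.exists_fixedPoint' Metric.isClosed_closedBall.isComplete
    hmaps h0m (edist_ne_top _ _)
  refine ⟨z, hz, ?_⟩
  have h1 : z - η • F z = z := hfix
  rw [sub_eq_self, smul_eq_zero] at h1
  exact h1.resolve_left hη0.ne'

end Monotone

/-! ### The equilibrium equation in the chart -/

namespace RankChart

variable {W H : Type*} [NormedAddCommGroup W] [InnerProductSpace ℝ W]
  [NormedAddCommGroup H] [InnerProductSpace ℝ H] {V : W → H} {w₀ : W}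

section Basic

variable (Q : RankChart V w₀)

theorem mem_ball_center : w₀ ∈ Metric.ball w₀ Q.R := Metric.mem_ball_self Q.R_pos

theorem zero_mem_ball : (0 : W) ∈ Metric.ball (0 : W) Q.δ := Metric.mem_ball_self Q.δ_pos

theorem Φ_center : Q.Φ w₀ = 0 := by
  have := Q.norm_Φ_le w₀ Q.mem_ball_center
  rwa [sub_self, norm_zero, mul_zero, norm_le_zero_iff] at this

theorem A_center : Q.A w₀ = ContinuousLinearMap.id ℝ W := by
  have := Q.norm_A_sub_le w₀
  rwa [sub_self, norm_zero, mul_zero, norm_le_zero_iff, sub_eq_zero] at this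

theorem J_zero : Q.J 0 = fderiv ℝ V w₀ := by
  rw [Q.fderiv_eq w₀ Q.mem_ball_center, Q.Φ_center, Q.A_center, ContinuousLinearMap.comp_id]

theorem ℓ_J_zero (x : W) : Q.ℓ (Q.J 0 x) = Q.P x := by
  have := DFunLike.congr_fun (Q.ℓ_fderiv w₀) x
  rwa [Q.A_center, ← Q.J_zero] at this

theorem norm_P_le_J_zero (x : W) : ‖Q.P x‖ ≤ (‖Q.ℓ‖ + 1) * ‖Q.J 0 x‖ := by
  rw [← Q.ℓ_J_zero]
  refine (Q.ℓ.le_opNorm _).trans ?_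
  gcongr
  linarith

theorem norm_J_le {z : W} (hz : z ∈ Metric.ball 0 Q.δ) : ‖Q.J z‖ ≤ ‖Q.J 0‖ + Q.C * Q.δ := by
  have h1 := Q.J_lipschitz z hz 0 Q.zero_mem_ball
  have h2 := norm_le_insert' (Q.J z) (Q.J 0)
  have h3 := Q.norm_P_le (z - 0)
  rw [sub_zero] at h1 h3
  rw [mem_ball_zero_iff] at hz
  have h4 := mul_le_mul_of_nonneg_left (h3.trans hz.le) Q.C_pos.le
  linarith

theorem norm_J_zero_sub_le (z z' : W) : ‖Q.J 0 (z - z')‖ ≤ ‖Q.J 0‖ * ‖Q.P (z - z')‖ := by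
  rw [← Q.J_P 0 Q.zero_mem_ball]
  exact (Q.J 0).le_opNorm _

theorem norm_g_sub_le {z z' : W} (hz : z ∈ Metric.ball 0 Q.δ) (hz' : z' ∈ Metric.ball 0 Q.δ) :
    ‖Q.g z - Q.g z'‖ ≤ (‖Q.J 0‖ + Q.C * Q.δ) * ‖Q.P (z - z')‖ := by
  have h1 := Q.g_approx Q.δ le_rfl z hz z' hz'
  have h2 := norm_le_insert' (Q.g z - Q.g z') (Q.J 0 (z - z'))
  have h3 := Q.norm_J_zero_sub_le z z'
  linarith

theorem norm_comp_g_le (hV0 : V w₀ = 0) {S : H → H} (hSl : ∀ u v, ‖S u - S v‖ ≤ 2 * ‖u - v‖)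
    {s : ℝ} (hs : s ≤ Q.δ) {z : W} (hz : z ∈ Metric.ball 0 s) :
    ‖S (Q.g z)‖ ≤ ‖S 0‖ + 2 * ((‖Q.J 0‖ + Q.C * Q.δ) * s) := by
  have hg0 : Q.g 0 = 0 := by
    rw [← Q.Φ_center, ← Q.V_eq w₀ Q.mem_ball_center, hV0]
  have h1 := Q.norm_g_sub_le (Metric.ball_subset_ball hs hz) Q.zero_mem_ball
  rw [hg0, sub_zero, sub_zero] at h1
  have h2 := hSl (Q.g z) 0
  rw [sub_zero] at h2
  have h3 := norm_le_insert' (S (Q.g z)) (S 0)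
  rw [mem_ball_zero_iff] at hz
  have h5 := Q.C_pos
  have h6 := Q.δ_pos
  have h4 : (‖Q.J 0‖ + Q.C * Q.δ) * ‖Q.P z‖ ≤ (‖Q.J 0‖ + Q.C * Q.δ) * s := by
    gcongr
    exact (Q.norm_P_le z).trans hz.le
  linarith

end Basic

variable [CompleteSpace W] [CompleteSpace H]

/-- The equilibrium equation `DV_w^* S (V_w) = 0` expressed in the chart. -/
noncomputable def residual (Q : RankChart V w₀) (S : H → H) (z : W) : W :=
  ContinuousLinearMap.adjoint (Q.J z) (S (Q.g z))

variable (Q : RankChart V w₀)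

theorem P_residual (S : H → H) {z : W} (hz : z ∈ Metric.ball 0 Q.δ) :
    Q.P (Q.residual S z) = Q.residual S z := by
  refine ext_inner_right ℝ fun x => ?_
  rw [Q.P_symm, residual, ContinuousLinearMap.adjoint_inner_left,
    ContinuousLinearMap.adjoint_inner_left, Q.J_P z hz]

theorem norm_residual_sub_le (hV0 : V w₀ = 0) {S : H → H}
    (hSl : ∀ u v, ‖S u - S v‖ ≤ 2 * ‖u - v‖) {z z' : W} (hz : z ∈ Metric.ball 0 Q.δ)
    (hz' : z' ∈ Metric.ball 0 Q.δ) :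
    ‖Q.residual S z - Q.residual S z'‖ ≤ (2 * (‖Q.J 0‖ + Q.C * Q.δ) ^ 2 +
      Q.C * (‖S 0‖ + 2 * ((‖Q.J 0‖ + Q.C * Q.δ) * Q.δ))) * ‖Q.P (z - z')‖ := by
  set E := ‖Q.J 0‖ + Q.C * Q.δ with hE
  have hC := Q.C_pos
  have hδ := Q.δ_pos
  have hE0 : 0 ≤ E := by positivity
  have e : Q.residual S z - Q.residual S z' =
      ContinuousLinearMap.adjoint (Q.J z) (S (Q.g z) - S (Q.g z')) +
        ContinuousLinearMap.adjoint (Q.J z - Q.J z') (S (Q.g z')) := by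
    simp only [residual, map_sub, sub_apply]; abel
  have h1 : ‖ContinuousLinearMap.adjoint (Q.J z) (S (Q.g z) - S (Q.g z'))‖ ≤
      E * (2 * (E * ‖Q.P (z - z')‖)) := by
    refine (ContinuousLinearMap.le_opNorm _ _).trans ?_
    rw [LinearIsometryEquiv.norm_map]
    refine mul_le_mul (Q.norm_J_le hz) ((hSl _ _).trans ?_) (norm_nonneg _) hE0
    gcongr
    exact Q.norm_g_sub_le hz hz'
  have h2 : ‖ContinuousLinearMap.adjoint (Q.J z - Q.J z') (S (Q.g z'))‖ ≤
      Q.C * ‖Q.P (z - z')‖ * (‖S 0‖ + 2 * (E * Q.δ)) := by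
    refine (ContinuousLinearMap.le_opNorm _ _).trans ?_
    rw [LinearIsometryEquiv.norm_map]
    exact mul_le_mul (Q.J_lipschitz z hz z' hz') (Q.norm_comp_g_le hV0 hSl le_rfl hz')
      (norm_nonneg _) (by positivity)
  rw [e]
  refine (norm_add_le _ _).trans ((add_le_add h1 h2).trans_eq ?_)
  ring

/-- On a small ball the residual inherits the strong monotonicity of `S`, because the tangent map
`J` hardly varies there and is bounded below on the range of `P`. -/
theorem residual_stronglyMonotone (hV0 : V w₀ = 0) {S : H → H} {k : ℝ} (hk : 0 < k)
    (hSl : ∀ u v, ‖S u - S v‖ ≤ 2 * ‖u - v‖)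
    (hSm : ∀ u v, k * ‖u - v‖ ^ 2 ≤ inner ℝ (S u - S v) (u - v)) {s : ℝ} (hs : s ≤ Q.δ)
    (hs1 : Q.C * s ≤ 1 / (2 * (‖Q.ℓ‖ + 1)))
    (hs2 : 6 * (‖Q.J 0‖ + Q.C * Q.δ) * Q.C * s + Q.C * ‖S 0‖ ≤ k / (8 * (‖Q.ℓ‖ + 1) ^ 2))
    {z z' : W} (hz : z ∈ Metric.ball 0 s) (hz' : z' ∈ Metric.ball 0 s) :
    k / (8 * (‖Q.ℓ‖ + 1) ^ 2) * ‖Q.P (z - z')‖ ^ 2 ≤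
      inner ℝ (Q.residual S z - Q.residual S z') (z - z') := by
  set E := ‖Q.J 0‖ + Q.C * Q.δ with hE
  set n := ‖Q.P (z - z')‖ with hn
  set Λ := ‖Q.ℓ‖ + 1 with hΛ
  have hΛ0 : 0 < Λ := by positivity
  have hC := Q.C_pos
  have hδ := Q.δ_pos
  have hE0 : 0 ≤ E := by positivity
  have hn0 : 0 ≤ n := norm_nonneg _
  have hzδ := Metric.ball_subset_ball hs hz
  have hzδ' := Metric.ball_subset_ball hs hz'
  have hs0 : 0 ≤ s := by
    rw [mem_ball_zero_iff] at hz; exact (norm_nonneg _).trans hz.le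
  set d := Q.g z - Q.g z' with hd
  have happ : ‖d - Q.J 0 (z - z')‖ ≤ Q.C * s * n := Q.g_approx s hs z hz z' hz'
  have hJz : ‖Q.J 0 (z - z') - Q.J z (z - z')‖ ≤ Q.C * s * n := by
    rw [← sub_apply]
    have e : (Q.J 0 - Q.J z) (z - z') = (Q.J 0 - Q.J z) (Q.P (z - z')) := by
      simp only [sub_apply, Q.J_P 0 Q.zero_mem_ball, Q.J_P z hzδ]
    rw [e]
    refine ((Q.J 0 - Q.J z).le_opNorm _).trans ?_
    refine mul_le_mul_of_nonneg_right ?_ hn0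
    refine (Q.J_lipschitz 0 Q.zero_mem_ball z hzδ).trans ?_
    refine mul_le_mul_of_nonneg_left ((Q.norm_P_le _).trans ?_) hC.le
    rw [mem_ball_zero_iff] at hz
    rw [zero_sub, norm_neg]
    exact hz.le
  have hdJ : ‖Q.J z (z - z') - d‖ ≤ 2 * (Q.C * s * n) := by
    have e : Q.J z (z - z') - d =
        -((d - Q.J 0 (z - z')) + (Q.J 0 (z - z') - Q.J z (z - z'))) := by abel
    rw [e, norm_neg]
    exact (norm_add_le _ _).trans (by linarith)
  have hdl : n / (2 * Λ) ≤ ‖d‖ := by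
    have h1 : n ≤ Λ * ‖Q.J 0 (z - z')‖ := Q.norm_P_le_J_zero (z - z')
    have h2 := norm_le_insert' (Q.J 0 (z - z')) d
    rw [norm_sub_rev (Q.J 0 (z - z')) d] at h2
    have h3 : Q.C * s * n ≤ 1 / (2 * Λ) * n := mul_le_mul_of_nonneg_right hs1 hn0
    have h4 : n / Λ ≤ ‖Q.J 0 (z - z')‖ := by
      rw [div_le_iff₀ hΛ0]; linarith
    have h5 : n / Λ = n / (2 * Λ) + 1 / (2 * Λ) * n := by field_simp; norm_num
    linarith
  have hdu : ‖d‖ ≤ E * n := Q.norm_g_sub_le hzδ hzδ'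
  have hsplit : inner ℝ (Q.residual S z - Q.residual S z') (z - z') =
      inner ℝ (S (Q.g z) - S (Q.g z')) d +
        inner ℝ (S (Q.g z) - S (Q.g z')) (Q.J z (z - z') - d) +
        inner ℝ (S (Q.g z')) ((Q.J z - Q.J z') (z - z')) := by
    simp only [residual, inner_sub_left, inner_sub_right, ContinuousLinearMap.adjoint_inner_left,
      sub_apply, map_sub]
    ring
  have h1 := hSm (Q.g z) (Q.g z')
  rw [← hd] at h1
  have h2 : -(4 * E * Q.C * s * n ^ 2) ≤
      inner ℝ (S (Q.g z) - S (Q.g z')) (Q.J z (z - z') - d) := by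
    have h := abs_real_inner_le_norm (S (Q.g z) - S (Q.g z')) (Q.J z (z - z') - d)
    have h' : ‖S (Q.g z) - S (Q.g z')‖ * ‖Q.J z (z - z') - d‖ ≤
        2 * (E * n) * (2 * (Q.C * s * n)) :=
      mul_le_mul ((hSl _ _).trans (by rw [← hd]; linarith)) hdJ (norm_nonneg _) (by positivity)
    have h'' := neg_abs_le (inner ℝ (S (Q.g z) - S (Q.g z')) (Q.J z (z - z') - d))
    nlinarith
  have h3 : -(Q.C * ‖S 0‖ * n ^ 2 + 2 * E * Q.C * s * n ^ 2) ≤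
      inner ℝ (S (Q.g z')) ((Q.J z - Q.J z') (z - z')) := by
    have e : (Q.J z - Q.J z') (z - z') = (Q.J z - Q.J z') (Q.P (z - z')) := by
      simp only [sub_apply, Q.J_P z hzδ, Q.J_P z' hzδ']
    have h := abs_real_inner_le_norm (S (Q.g z')) ((Q.J z - Q.J z') (z - z'))
    have h' : ‖S (Q.g z')‖ * ‖(Q.J z - Q.J z') (z - z')‖ ≤
        (‖S 0‖ + 2 * (E * s)) * (Q.C * n * n) := by
      refine mul_le_mul (Q.norm_comp_g_le hV0 hSl hs hz') ?_ (norm_nonneg _) (by positivity)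
      rw [e]
      refine ((Q.J z - Q.J z').le_opNorm _).trans ?_
      exact mul_le_mul_of_nonneg_right (Q.J_lipschitz z hzδ z' hzδ') hn0
    have h'' := neg_abs_le (inner ℝ (S (Q.g z')) ((Q.J z - Q.J z') (z - z')))
    nlinarith
  have h4 : k * (n / (2 * Λ)) ^ 2 ≤ k * ‖d‖ ^ 2 := by gcongr
  have h5 : k * (n / (2 * Λ)) ^ 2 = 2 * (k / (8 * Λ ^ 2)) * n ^ 2 := by field_simp; norm_num
  have h6 := mul_le_mul_of_nonneg_right hs2 (sq_nonneg n)
  rw [hsplit]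
  nlinarith

/-- For every strongly monotone `S` with `S 0` small, the residual has a zero of size
`O(‖S 0‖)`, and the residual is comparable with the distance of `P z` to that of the zero. The
constants depend on the chart and on the modulus `k` of monotonicity only. -/
theorem exists_zero_residual (hV0 : V w₀ = 0) {k : ℝ} (hk : 0 < k) :
    ∃ m > (0 : ℝ), ∃ s > (0 : ℝ), ∃ η > (0 : ℝ), ∃ K > (0 : ℝ), s ≤ Q.δ ∧
      ∀ S : H → H, (∀ u v, ‖S u - S v‖ ≤ 2 * ‖u - v‖) →
        (∀ u v, k * ‖u - v‖ ^ 2 ≤ inner ℝ (S u - S v) (u - v)) → ‖S 0‖ ≤ η →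
        ∃ zStar ∈ Metric.ball (0 : W) s, ‖zStar‖ ≤ K * ‖S 0‖ ∧ ∀ z ∈ Metric.ball (0 : W) s,
          m * ‖Q.P (z - zStar)‖ ^ 2 ≤ inner ℝ (Q.P (z - zStar)) (Q.residual S z) ∧
          ‖Q.residual S z‖ ≤ K * ‖Q.P (z - zStar)‖ ∧
          ‖Q.g z - Q.g zStar‖ ≤ K * ‖Q.P (z - zStar)‖ := by
  set E := ‖Q.J 0‖ + Q.C * Q.δ with hE
  set Λ := ‖Q.ℓ‖ + 1 with hΛ
  have hΛ0 : 0 < Λ := by positivity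
  have hC := Q.C_pos
  have hδ := Q.δ_pos
  have hE0 : 0 < E := by positivity
  set m := k / (8 * Λ ^ 2) with hm
  have hm0 : 0 < m := by positivity
  set s := min Q.δ (min (1 / (2 * Λ * Q.C)) (m / (12 * E * Q.C))) with hs
  have hs0 : 0 < s := by positivity
  have hsδ : s ≤ Q.δ := min_le_left _ _
  have hs1 : Q.C * s ≤ 1 / (2 * Λ) := by
    have h : s ≤ 1 / (2 * Λ * Q.C) := (min_le_right _ _).trans (min_le_left _ _)
    calc Q.C * s ≤ Q.C * (1 / (2 * Λ * Q.C)) := by gcongr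
      _ = 1 / (2 * Λ) := by field_simp
  have hs2 : 6 * E * Q.C * s ≤ m / 2 := by
    have h : s ≤ m / (12 * E * Q.C) := (min_le_right _ _).trans (min_le_right _ _)
    calc 6 * E * Q.C * s ≤ 6 * E * Q.C * (m / (12 * E * Q.C)) := by gcongr
      _ = m / 2 := by field_simp; norm_num
  set m' := min m 1 with hm'
  have hm'0 : 0 < m' := by positivity
  set η := min (m / (2 * Q.C)) (m' * (s / 2) / (2 * E)) with hη
  have hη0 : 0 < η := by positivity
  set K₁ := 2 * E ^ 2 + Q.C * (η + 2 * (E * Q.δ)) with hK₁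
  have hK₁0 : 0 < K₁ := by positivity
  set K := K₁ + E + E / m' with hK
  refine ⟨m, hm0, s, hs0, η, hη0, K, by positivity, hsδ, fun S hSl hSm hS0 => ?_⟩
  have hηC : Q.C * ‖S 0‖ ≤ m / 2 := by
    calc Q.C * ‖S 0‖ ≤ Q.C * (m / (2 * Q.C)) := by
          gcongr; exact hS0.trans (min_le_left _ _)
      _ = m / 2 := by field_simp
  have hmono : ∀ z ∈ Metric.ball (0 : W) s, ∀ z' ∈ Metric.ball (0 : W) s,
      m * ‖Q.P (z - z')‖ ^ 2 ≤ inner ℝ (Q.residual S z - Q.residual S z') (z - z') :=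
    fun z hz z' hz' => Q.residual_stronglyMonotone hV0 hk hSl hSm hsδ hs1
      (by linarith) hz hz'
  have hlip : ∀ z ∈ Metric.ball (0 : W) s, ∀ z' ∈ Metric.ball (0 : W) s,
      ‖Q.residual S z - Q.residual S z'‖ ≤ K₁ * ‖Q.P (z - z')‖ := fun z hz z' hz' => by
    refine (Q.norm_residual_sub_le hV0 hSl (Metric.ball_subset_ball hsδ hz)
      (Metric.ball_subset_ball hsδ hz')).trans ?_
    refine mul_le_mul_of_nonneg_right ?_ (norm_nonneg _)
    rw [← hE, hK₁]
    gcongr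
  -- adding the projection onto the kernel of `P` makes the residual strongly monotone
  set F : W → W := fun z => Q.residual S z + (z - Q.P z) with hF
  have hPythagoras : ∀ x, ‖x‖ ^ 2 = ‖Q.P x‖ ^ 2 + inner ℝ (x - Q.P x) x := by
    intro x
    rw [← real_inner_self_eq_norm_sq, ← real_inner_self_eq_norm_sq, Q.P_symm, Q.P_idem,
      inner_sub_left, Q.P_symm]
    ring
  have hker : ∀ x, 0 ≤ inner ℝ (x - Q.P x) x := by
    intro x
    have h1 := hPythagoras x
    have h2 := pow_le_pow_left₀ (norm_nonneg _) (Q.norm_P_le x) 2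
    linarith
  have hFmono : ∀ z ∈ Metric.ball (0 : W) s, ∀ z' ∈ Metric.ball (0 : W) s,
      m' * ‖z - z'‖ ^ 2 ≤ inner ℝ (F z - F z') (z - z') := by
    intro z hz z' hz'
    have e : F z - F z' = (Q.residual S z - Q.residual S z') +
        ((z - z') - Q.P (z - z')) := by
      simp only [hF, map_sub]; abel
    rw [e, inner_add_left, hPythagoras (z - z'), mul_add]
    refine add_le_add (le_trans ?_ (hmono z hz z' hz')) ?_
    · gcongr
      exact min_le_left _ _
    · exact mul_le_of_le_one_left (hker _) (min_le_right _ _)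
  have hFlip : ∀ z ∈ Metric.ball (0 : W) s, ∀ z' ∈ Metric.ball (0 : W) s,
      ‖F z - F z'‖ ≤ (K₁ + 2) * ‖z - z'‖ := by
    intro z hz z' hz'
    have e : F z - F z' = (Q.residual S z - Q.residual S z') +
        ((z - z') - Q.P (z - z')) := by
      simp only [hF, map_sub]; abel
    rw [e]
    have h1 := hlip z hz z' hz'
    have h2 := Q.norm_P_le (z - z')
    have h3 := norm_add_le (Q.residual S z - Q.residual S z') ((z - z') - Q.P (z - z'))
    have h4 := norm_sub_le (z - z') (Q.P (z - z'))
    have h5 := mul_le_mul_of_nonneg_left h2 hK₁0.le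
    linarith
  have h0 : (0 : W) ∈ Metric.ball (0 : W) s := Metric.mem_ball_self hs0
  have hg0 : Q.g 0 = 0 := by
    rw [← Q.Φ_center, ← Q.V_eq w₀ Q.mem_ball_center, hV0]
  have hF0 : ‖F 0‖ ≤ E * ‖S 0‖ := by
    have e : F 0 = ContinuousLinearMap.adjoint (Q.J 0) (S 0) := by
      simp [hF, residual, hg0]
    rw [e]
    refine (ContinuousLinearMap.le_opNorm _ _).trans ?_
    rw [LinearIsometryEquiv.norm_map]
    gcongr
    rw [hE]
    have := mul_pos hC hδ
    linarith
  have hcb : Metric.closedBall (0 : W) (s / 2) ⊆ Metric.ball (0 : W) s :=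
    Metric.closedBall_subset_ball (by linarith)
  obtain ⟨zStar, hzs, hFz⟩ := exists_zero_of_stronglyMonotone (F := F) (m := m') (K := K₁ + 2)
    (s := s / 2) hm'0 (by have : m' ≤ 1 := min_le_right _ _
                          linarith) (by positivity)
    (fun z hz z' hz' => hFmono z (hcb hz) z' (hcb hz'))
    (fun z hz z' hz' => hFlip z (hcb hz) z' (hcb hz')) (by
      refine hF0.trans ?_
      calc E * ‖S 0‖ ≤ E * (m' * (s / 2) / (2 * E)) := by
            gcongr; exact hS0.trans (min_le_right _ _)
        _ = m' * (s / 2) / 2 := by field_simp)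
  have hzb := hcb hzs
  have hres : Q.residual S zStar = 0 := by
    have h1 : Q.P (F zStar) = Q.residual S zStar := by
      simp [hF, Q.P_residual S (Metric.ball_subset_ball hsδ hzb), Q.P_idem]
    rw [← h1, hFz, map_zero]
  refine ⟨zStar, hzb, ?_, fun z hz => ⟨?_, ?_, ?_⟩⟩
  · have h1 := hFmono zStar hzb 0 h0
    rw [hFz, zero_sub, sub_zero, inner_neg_left] at h1
    have h2 := neg_le_of_abs_le (abs_real_inner_le_norm (F 0) zStar)
    have h3 : m' * ‖zStar‖ ≤ ‖F 0‖ := by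
      rcases (norm_nonneg zStar).eq_or_lt with h | h
      · rw [← h, mul_zero]; exact norm_nonneg _
      · nlinarith
    have h4 : ‖zStar‖ ≤ E / m' * ‖S 0‖ := by
      rw [div_mul_eq_mul_div, le_div_iff₀ hm'0]
      linarith
    refine h4.trans ?_
    gcongr
    rw [hK]
    linarith
  · have h1 := hmono z hz zStar hzb
    rw [hres, sub_zero] at h1
    rw [Q.P_symm, Q.P_residual S (Metric.ball_subset_ball hsδ hz), real_inner_comm]
    exact h1
  · have h1 := hlip z hz zStar hzb
    rw [hres, sub_zero] at h1
    refine h1.trans ?_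
    have : 0 < E / m' := by positivity
    gcongr
    rw [hK]
    linarith
  · refine (Q.norm_g_sub_le (Metric.ball_subset_ball hsδ hz)
      (Metric.ball_subset_ball hsδ hzb)).trans ?_
    have : 0 < E / m' := by positivity
    gcongr
    rw [hK, ← hE]
    linarith

end RankChart

/-! ### The dynamics near a point of locally constant rank -/

section Dynamics

variable {W H : Type*} [NormedAddCommGroup W] [InnerProductSpace ℝ W]
  [NormedAddCommGroup H] [InnerProductSpace ℝ H]

theorem norm_sub_sub_fderiv_le {V : W → H} (hV : Differentiable ℝ V) {L : ℝ≥0}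
    (hDV : LipschitzWith L (fderiv ℝ V)) (w₀ w : W) :
    ‖V w - V w₀ - fderiv ℝ V w₀ (w - w₀)‖ ≤ L * ‖w - w₀‖ ^ 2 := by
  have h := (convex_closedBall w₀ ‖w - w₀‖).norm_image_sub_le_of_norm_hasFDerivWithin_le'
    (f := V) (φ := fderiv ℝ V w₀) (C := L * ‖w - w₀‖)
    (fun x _ => (hV x).hasFDerivAt.hasFDerivWithinAt) (fun x hx => ?_)
    (Metric.mem_closedBall_self (norm_nonneg _))
    (by rw [Metric.mem_closedBall, dist_eq_norm] : w ∈ Metric.closedBall w₀ ‖w - w₀‖)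
  · rwa [mul_assoc, ← sq] at h
  · have h1 := hDV.dist_le_mul x w₀
    rw [dist_eq_norm] at h1
    exact h1.trans (mul_le_mul_of_nonneg_left hx L.coe_nonneg)

theorem eqOn_of_solution_of_lipschitzOnWith {X : W → W} {K : ℝ≥0} {s : Set W}
    (hX : LipschitzOnWith K X s) {u v : ℝ → W}
    (hu : ∀ t ∈ Set.Ici (0 : ℝ), HasDerivWithinAt u (X (u t)) (Set.Ici 0) t)
    (hv : ∀ t ∈ Set.Ici (0 : ℝ), HasDerivWithinAt v (X (v t)) (Set.Ici 0) t)
    (hus : ∀ t : ℝ, 0 ≤ t → u t ∈ s) (hvs : ∀ t : ℝ, 0 ≤ t → v t ∈ s) (h0 : u 0 = v 0) :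
    Set.EqOn u v (Set.Ici 0) := by
  intro t ht
  refine ODE_solution_unique_of_mem_Icc_right (v := fun _ => X) (s := fun _ => s) (K := K)
    (a := 0) (b := t) (fun _ _ => hX)
    (fun r hr => ((hu r hr.1).continuousWithinAt).mono fun x hx => hx.1)
    (fun r hr => (hu r hr.1).mono fun x hx => hr.1.trans hx) (fun r hr => hus r hr.1)
    (fun r hr => ((hv r hr.1).continuousWithinAt).mono fun x hx => hx.1)
    (fun r hr => (hv r hr.1).mono fun x hx => hr.1.trans hx) (fun r hr => hvs r hr.1) h0 ⟨ht, le_rfl⟩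

variable [CompleteSpace W] [CompleteSpace H]

/-- The vector field `w ↦ -DV_w^* S (V_w)`, which drives `V_w` towards a zero of `S`. -/
noncomputable def pullbackField (V : W → H) (S : H → H) (w : W) : W :=
  -ContinuousLinearMap.adjoint (fderiv ℝ V w) (S (V w))

theorem exists_lipschitzOnWith_pullbackField {V : W → H} (hV : Differentiable ℝ V) {L : ℝ≥0}
    (hDV : LipschitzWith L (fderiv ℝ V)) {S : H → H}
    (hSl : ∀ u v, ‖S u - S v‖ ≤ 2 * ‖u - v‖) (w₀ : W) {R : ℝ} (hR : 0 ≤ R) :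
    ∃ K : ℝ≥0, LipschitzOnWith K (pullbackField V S) (Metric.closedBall w₀ R) := by
  have hDVn : ∀ w w', ‖fderiv ℝ V w - fderiv ℝ V w'‖ ≤ L * ‖w - w'‖ := fun w w' => by
    simpa [dist_eq_norm] using hDV.dist_le_mul w w'
  set b : ℝ := ‖fderiv ℝ V w₀‖ + L * R with hb
  have hb0 : 0 ≤ b := by positivity
  have hDVb : ∀ w ∈ Metric.closedBall w₀ R, ‖fderiv ℝ V w‖ ≤ b := by
    intro w hw
    rw [Metric.mem_closedBall, dist_eq_norm] at hw
    have h1 := norm_le_insert' (fderiv ℝ V w) (fderiv ℝ V w₀)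
    have h2 := (hDVn w w₀).trans (mul_le_mul_of_nonneg_left hw L.coe_nonneg)
    linarith
  have hVl : ∀ w ∈ Metric.closedBall w₀ R, ∀ w' ∈ Metric.closedBall w₀ R,
      ‖V w - V w'‖ ≤ b * ‖w - w'‖ := fun w hw w' hw' =>
    (convex_closedBall w₀ R).norm_image_sub_le_of_norm_fderiv_le (fun x _ => hV x) hDVb hw' hw
  set B : ℝ := ‖S (V w₀)‖ + 2 * (b * R) with hB
  have hSb : ∀ w ∈ Metric.closedBall w₀ R, ‖S (V w)‖ ≤ B := by
    intro w hw
    have h1 := norm_le_insert' (S (V w)) (S (V w₀))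
    have h2 := hSl (V w) (V w₀)
    have h3 := hVl w hw w₀ (Metric.mem_closedBall_self hR)
    rw [Metric.mem_closedBall, dist_eq_norm] at hw
    have h4 := mul_le_mul_of_nonneg_left hw hb0
    linarith
  have hB0 : 0 ≤ B := by positivity
  refine ⟨(L * B + b * (2 * b)).toNNReal, LipschitzOnWith.of_dist_le_mul fun w hw w' hw' => ?_⟩
  rw [dist_eq_norm, dist_eq_norm, Real.coe_toNNReal _ (by positivity)]
  have e : pullbackField V S w - pullbackField V S w' =
      -(ContinuousLinearMap.adjoint (fderiv ℝ V w - fderiv ℝ V w') (S (V w)) +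
        ContinuousLinearMap.adjoint (fderiv ℝ V w') (S (V w) - S (V w'))) := by
    simp only [pullbackField, map_sub, sub_apply]; abel
  have h1 : ‖ContinuousLinearMap.adjoint (fderiv ℝ V w - fderiv ℝ V w') (S (V w))‖ ≤
      L * ‖w - w'‖ * B := by
    refine (ContinuousLinearMap.le_opNorm _ _).trans ?_
    rw [LinearIsometryEquiv.norm_map]
    exact mul_le_mul (hDVn _ _) (hSb w hw) (norm_nonneg _) (by positivity)
  have h2 : ‖ContinuousLinearMap.adjoint (fderiv ℝ V w') (S (V w) - S (V w'))‖ ≤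
      b * (2 * (b * ‖w - w'‖)) := by
    refine (ContinuousLinearMap.le_opNorm _ _).trans ?_
    rw [LinearIsometryEquiv.norm_map]
    refine mul_le_mul (hDVb _ hw') ((hSl _ _).trans ?_) (norm_nonneg _) hb0
    gcongr
    exact hVl w hw w' hw'
  rw [e, norm_neg]
  refine (norm_add_le _ _).trans ((add_le_add h1 h2).trans_eq ?_)
  ring

/-- In the chart the observable `w ↦ ℓ (V_w) - P zStar` is a Lyapunov observable of the pullback
field, because the chart is almost isometric near `w₀`, and it controls both the field and the
distance to equilibrium. -/
theorem RankChart.exists_lyapunov {V : W → H} {w₀ : W} (Q : RankChart V w₀) (hV0 : V w₀ = 0)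
    {k : ℝ} (hk : 0 < k) :
    ∃ c > (0 : ℝ), ∃ R > (0 : ℝ), ∃ η > (0 : ℝ), ∃ K > (0 : ℝ),
      ∀ S : H → H, (∀ u v, ‖S u - S v‖ ≤ 2 * ‖u - v‖) →
        (∀ u v, k * ‖u - v‖ ^ 2 ≤ inner ℝ (S u - S v) (u - v)) → ‖S 0‖ ≤ η →
        ∃ y : W, ∃ vStar : H, ‖y‖ ≤ K * ‖S 0‖ ∧ ∀ w ∈ Metric.ball w₀ R,
          inner ℝ (Q.ℓ (V w) - y) (Q.ℓ.comp (fderiv ℝ V w) (pullbackField V S w)) ≤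
            -c * ‖Q.ℓ (V w) - y‖ ^ 2 ∧
          ‖pullbackField V S w‖ ≤ K * ‖Q.ℓ (V w) - y‖ ∧
          ‖V w - vStar‖ ≤ K * ‖Q.ℓ (V w) - y‖ := by
  obtain ⟨m, hm, s, hs, η, hη, K, hK, hsδ, hmain⟩ := Q.exists_zero_residual hV0 hk
  have hC := Q.C_pos
  set R := min Q.R (min (s / Q.C) (min (1 / Q.C) (m / (6 * K * Q.C)))) with hR
  have hRQ : R ≤ Q.R := min_le_left _ _
  have hR0 : 0 < R := lt_min Q.R_pos (by positivity)
  have hRs : Q.C * R ≤ s := by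
    have h : R ≤ s / Q.C := (min_le_right _ _).trans (min_le_left _ _)
    calc Q.C * R ≤ Q.C * (s / Q.C) := by gcongr
      _ = s := by field_simp
  have hR1 : Q.C * R ≤ 1 := by
    have h : R ≤ 1 / Q.C :=
      (min_le_right _ _).trans ((min_le_right _ _).trans (min_le_left _ _))
    calc Q.C * R ≤ Q.C * (1 / Q.C) := by gcongr
      _ = 1 := by field_simp
  have hRm : 3 * (Q.C * R) * K ≤ m / 2 := by
    have h : R ≤ m / (6 * K * Q.C) :=
      (min_le_right _ _).trans ((min_le_right _ _).trans (min_le_right _ _))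
    calc 3 * (Q.C * R) * K ≤ 3 * (Q.C * (m / (6 * K * Q.C))) * K := by gcongr
      _ = m / 2 := by field_simp; norm_num
  refine ⟨m / 2, by positivity, R, hR0, η, hη, 2 * K, by positivity, fun S hSl hSm hS0 => ?_⟩
  obtain ⟨zStar, hzb, hzn, hz⟩ := hmain S hSl hSm hS0
  refine ⟨Q.P zStar, Q.g zStar, ?_, fun w hw => ?_⟩
  · have := mul_nonneg hK.le (norm_nonneg (S 0))
    linarith [Q.norm_P_le zStar]
  have hwQ := Metric.ball_subset_ball hRQ hw
  have hwR : ‖w - w₀‖ < R := by rwa [Metric.mem_ball, dist_eq_norm] at hw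
  have hzw : Q.Φ w ∈ Metric.ball (0 : W) s := by
    rw [mem_ball_zero_iff]
    calc ‖Q.Φ w‖ ≤ Q.C * ‖w - w₀‖ := Q.norm_Φ_le w hwQ
      _ < Q.C * R := by gcongr
      _ ≤ s := hRs
  obtain ⟨h1, h2, h3⟩ := hz _ hzw
  have hY : Q.ℓ (V w) - Q.P zStar = Q.P (Q.Φ w - zStar) := by rw [map_sub, Q.P_Φ]
  rw [hY]
  set Y := Q.P (Q.Φ w - zStar) with hYdef
  set F := Q.residual S (Q.Φ w) with hF
  have hX : pullbackField V S w = -ContinuousLinearMap.adjoint (Q.A w) F := by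
    rw [pullbackField, Q.fderiv_eq w hwQ, ContinuousLinearMap.adjoint_comp, Q.V_eq w hwQ]
    rfl
  set T := Q.A w - ContinuousLinearMap.id ℝ W with hT
  have hTn : ‖T‖ ≤ Q.C * R := (Q.norm_A_sub_le w).trans (by gcongr)
  have hA : ∀ x, ContinuousLinearMap.adjoint (Q.A w) x = x + ContinuousLinearMap.adjoint T x := by
    intro x
    have e : Q.A w = ContinuousLinearMap.id ℝ W + T := by rw [hT]; abel
    rw [e, map_add, ContinuousLinearMap.adjoint_id]
    rfl
  have hTx : ∀ x, ‖ContinuousLinearMap.adjoint T x‖ ≤ Q.C * R * ‖x‖ := fun x => by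
    refine (ContinuousLinearMap.le_opNorm _ _).trans ?_
    rw [LinearIsometryEquiv.norm_map]
    gcongr
  have hCR : 0 ≤ Q.C * R := by positivity
  refine ⟨?_, ?_, ?_⟩
  · have e : inner ℝ Y (Q.ℓ.comp (fderiv ℝ V w) (pullbackField V S w)) =
        -(inner ℝ Y F + inner ℝ Y (ContinuousLinearMap.adjoint T F) +
          inner ℝ (ContinuousLinearMap.adjoint T Y) F +
          inner ℝ (ContinuousLinearMap.adjoint T Y) (ContinuousLinearMap.adjoint T F)) := by
      rw [Q.ℓ_fderiv, hX, ContinuousLinearMap.comp_apply, ← Q.P_symm, hYdef, Q.P_idem, ← hYdef,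
        map_neg, inner_neg_right, ← ContinuousLinearMap.adjoint_inner_left, hA Y, hA F]
      simp only [inner_add_left, inner_add_right]
      ring
    have i1 := neg_le_of_abs_le (abs_real_inner_le_norm Y (ContinuousLinearMap.adjoint T F))
    have i2 := neg_le_of_abs_le (abs_real_inner_le_norm (ContinuousLinearMap.adjoint T Y) F)
    have i3 := neg_le_of_abs_le (abs_real_inner_le_norm (ContinuousLinearMap.adjoint T Y)
      (ContinuousLinearMap.adjoint T F))
    have hFK : ‖F‖ ≤ K * ‖Y‖ := h2
    have b1 : ‖Y‖ * ‖ContinuousLinearMap.adjoint T F‖ ≤ ‖Y‖ * (Q.C * R * (K * ‖Y‖)) := by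
      gcongr
      exact (hTx F).trans (by gcongr)
    have b2 : ‖ContinuousLinearMap.adjoint T Y‖ * ‖F‖ ≤ Q.C * R * ‖Y‖ * (K * ‖Y‖) :=
      mul_le_mul (hTx Y) hFK (norm_nonneg _) (by positivity)
    have b3 : ‖ContinuousLinearMap.adjoint T Y‖ * ‖ContinuousLinearMap.adjoint T F‖ ≤
        Q.C * R * ‖Y‖ * (1 * (K * ‖Y‖)) :=
      mul_le_mul (hTx Y) ((hTx F).trans (by gcongr)) (norm_nonneg _) (by positivity)
    have b4 := mul_le_mul_of_nonneg_right hRm (sq_nonneg ‖Y‖)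
    rw [e]
    nlinarith
  · rw [hX, norm_neg, hA F]
    have b1 : Q.C * R * ‖F‖ ≤ 1 * ‖F‖ := by gcongr
    have b2 := norm_add_le F (ContinuousLinearMap.adjoint T F)
    have b3 := hTx F
    linarith
  · rw [Q.V_eq w hwQ]
    have := mul_nonneg hK.le (norm_nonneg Y)
    linarith

/-- The pullback field of a strongly monotone `S` with `S 0` small: near `w₀` all trajectories
converge exponentially fast to equilibria with the same value `V wStar`, and that of `w₀` has
length `O(‖S 0‖)`. All constants are uniform in `S`. -/
theorem exists_attracting_equilibrium {V : W → H} (hV : Differentiable ℝ V) {L : ℝ≥0}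
    (hDV : LipschitzWith L (fderiv ℝ V)) {w₀ : W} (Q : RankChart V w₀) (hV0 : V w₀ = 0)
    {k : ℝ} (hk : 0 < k) :
    ∃ η > (0 : ℝ), ∃ ρ > (0 : ℝ), ∃ c > (0 : ℝ), ∃ K > (0 : ℝ),
      ∀ S : H → H, (∀ u v, ‖S u - S v‖ ≤ 2 * ‖u - v‖) →
        (∀ u v, k * ‖u - v‖ ^ 2 ≤ inner ℝ (S u - S v) (u - v)) → ‖S 0‖ ≤ η →
        ∃ wStar ∈ Metric.ball w₀ ρ, ‖wStar - w₀‖ ≤ K * ‖S 0‖ ∧ pullbackField V S wStar = 0 ∧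
          (∀ w₁ ∈ Metric.ball w₀ ρ, ∃ w : ℝ → W, w 0 = w₁ ∧
            ∀ t ∈ Set.Ici (0 : ℝ), HasDerivWithinAt w (pullbackField V S (w t)) (Set.Ici 0) t) ∧
          ∀ w : ℝ → W, w 0 ∈ Metric.ball w₀ ρ →
            (∀ t ∈ Set.Ici (0 : ℝ),
              HasDerivWithinAt w (pullbackField V S (w t)) (Set.Ici 0) t) →
            (w 0 = w₀ → ∀ t : ℝ, 0 ≤ t → ‖w t - wStar‖ ≤ K * Real.exp (-c * t) ∧
              ‖V (w t) - V wStar‖ ≤ K * ‖S 0‖ * Real.exp (-c * t)) ∧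
            (∃ wInf, pullbackField V S wInf = 0 ∧ V wInf = V wStar ∧
              ∀ t : ℝ, 0 ≤ t → ‖w t - wInf‖ ≤ K * Real.exp (-c * t)) ∧
            ∀ t : ℝ, 0 ≤ t → ‖V (w t) - V wStar‖ ≤
              K * ‖V (w 0) - V wStar‖ * Real.exp (-c * t) := by
  obtain ⟨c, hc, R, hR, η₀, hη₀, K₀, hK₀, hmain⟩ := Q.exists_lyapunov hV0 hk
  -- `ℓ ∘ V` is Lipschitz near `w₀`
  set b : ℝ := ‖Q.ℓ‖ * (‖fderiv ℝ V w₀‖ + L * R) with hb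
  have hb0 : 0 ≤ b := by positivity
  have hℓV : ∀ w ∈ Metric.ball w₀ R, ‖Q.ℓ (V w)‖ ≤ b * ‖w - w₀‖ := by
    intro w hw
    rw [Metric.mem_ball, dist_eq_norm] at hw
    have h1 := norm_sub_sub_fderiv_le hV hDV w₀ w
    rw [hV0, sub_zero] at h1
    have h2 := norm_le_insert' (V w) (fderiv ℝ V w₀ (w - w₀))
    have h3 := (fderiv ℝ V w₀).le_opNorm (w - w₀)
    have h4 : (L : ℝ) * ‖w - w₀‖ ^ 2 ≤ L * R * ‖w - w₀‖ := by
      rw [sq, ← mul_assoc]; gcongr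
    calc ‖Q.ℓ (V w)‖ ≤ ‖Q.ℓ‖ * ‖V w‖ := Q.ℓ.le_opNorm _
      _ ≤ ‖Q.ℓ‖ * ((‖fderiv ℝ V w₀‖ + L * R) * ‖w - w₀‖) := by gcongr; linarith
      _ = b * ‖w - w₀‖ := by rw [hb]; ring
  set a := K₀ / c with ha
  have ha0 : 0 < a := by positivity
  -- trajectories from the ball of radius `ρ` have length at most `R - ρ`
  set ρ := R / (2 * (1 + a * b)) with hρ
  have hρ0 : 0 < ρ := by positivity
  have hρR : (1 + a * b) * ρ = R / 2 := by rw [hρ]; field_simp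
  have hρR' : ρ ≤ R / 2 := by nlinarith [mul_nonneg ha0.le hb0]
  set η := min η₀ (min (R / (4 * (a * K₀))) (ρ / (2 * (a * K₀)))) with hη
  have hη0 : 0 < η := by positivity
  set K := R + a * K₀ + K₀ * K₀ + K₀ * ‖Q.ℓ‖ with hK
  have hK0 : 0 < K := by positivity
  refine ⟨η, hη0, ρ, hρ0, c, hc, K, hK0, fun S hSl hSm hS0 => ?_⟩
  obtain ⟨y, vStar, hy, hY⟩ := hmain S hSl hSm (hS0.trans (min_le_left _ _))
  set X := pullbackField V S with hX
  have hay : a * ‖y‖ ≤ a * K₀ * ‖S 0‖ := by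
    rw [mul_assoc]; gcongr
  have hay1 : a * K₀ * ‖S 0‖ ≤ R / 4 := by
    have h : ‖S 0‖ ≤ R / (4 * (a * K₀)) :=
      hS0.trans ((min_le_right _ _).trans (min_le_left _ _))
    calc a * K₀ * ‖S 0‖ ≤ a * K₀ * (R / (4 * (a * K₀))) := by gcongr
      _ = R / 4 := by field_simp
  have hay2 : a * K₀ * ‖S 0‖ ≤ ρ / 2 := by
    have h : ‖S 0‖ ≤ ρ / (2 * (a * K₀)) :=
      hS0.trans ((min_le_right _ _).trans (min_le_right _ _))
    calc a * K₀ * ‖S 0‖ ≤ a * K₀ * (ρ / (2 * (a * K₀))) := by gcongr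
      _ = ρ / 2 := by field_simp
  set Y : W → W := fun w => Q.ℓ (V w) - y with hYdef
  have hYd : ∀ w, HasFDerivAt Y (Q.ℓ.comp (fderiv ℝ V w)) w := fun w =>
    (Q.ℓ.hasFDerivAt.comp w (hV w).hasFDerivAt).sub_const y
  have hsmall : ∀ w₁ ∈ Metric.ball w₀ ρ, ‖w₁ - w₀‖ + a * ‖Y w₁‖ < R := by
    intro w₁ hw₁
    have h1 := hℓV w₁ (Metric.ball_subset_ball (by linarith) hw₁)
    rw [Metric.mem_ball, dist_eq_norm] at hw₁
    have h2 : ‖Y w₁‖ ≤ ‖Q.ℓ (V w₁)‖ + ‖y‖ := norm_sub_le _ _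
    have h3 : a * ‖Y w₁‖ ≤ a * (b * ‖w₁ - w₀‖ + ‖y‖) := by gcongr; linarith
    have h4 : (1 + a * b) * ‖w₁ - w₀‖ ≤ (1 + a * b) * ρ := by gcongr
    linarith
  -- the field may be replaced by one with global solutions
  obtain ⟨κ, hκ⟩ := exists_lipschitzOnWith_pullbackField hV hDV hSl w₀ hR.le
  obtain ⟨X', hX', hsol⟩ := exists_global_solution_of_lipschitzOnWith hR.le hκ
  have hbc : Metric.ball w₀ R ⊆ Metric.closedBall w₀ R := Metric.ball_subset_closedBall
  have hex : ∀ w₁ ∈ Metric.ball w₀ ρ, ∃ w : ℝ → W, w 0 = w₁ ∧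
      ∀ t ∈ Set.Ici (0 : ℝ), HasDerivWithinAt w (X (w t)) (Set.Ici 0) t := by
    intro w₁ hw₁
    obtain ⟨w, hw0, hw⟩ := hsol w₁
    obtain ⟨hin, -, -⟩ := exists_limit_of_lyapunov (X := X') (Y := Y) (R := R) hc hK₀.le
      (fun w _ => hYd w) (fun w hw => by rw [hX' (hbc hw)]; exact (hY w hw).1)
      (fun w hw => by rw [hX' (hbc hw)]; exact (hY w hw).2.1) hw
      (by rw [hw0]; exact hsmall w₁ hw₁)
    refine ⟨w, hw0, fun t ht => ?_⟩
    have := hw t ht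
    rwa [hX' (hbc (hin t ht))] at this
  have hlim : ∀ w : ℝ → W, w 0 ∈ Metric.ball w₀ ρ →
      (∀ t ∈ Set.Ici (0 : ℝ), HasDerivWithinAt w (X (w t)) (Set.Ici 0) t) →
      (∀ t : ℝ, 0 ≤ t → w t ∈ Metric.ball w₀ R) ∧
      (∀ t : ℝ, 0 ≤ t → ‖Y (w t)‖ ≤ Real.exp (-c * t) * ‖Y (w 0)‖) ∧
      ∃ wInf ∈ Metric.ball w₀ R, X wInf = 0 ∧ Y wInf = 0 ∧
        ∀ t : ℝ, 0 ≤ t → ‖w t - wInf‖ ≤ a * ‖Y (w 0)‖ * Real.exp (-c * t) :=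
    fun w hw0 hw => exists_limit_of_lyapunov (X := X) (Y := Y) (R := R) hc hK₀.le
      (fun w _ => hYd w) (fun w hw => (hY w hw).1) (fun w hw => (hY w hw).2.1) hw (hsmall _ hw0)
  have hVstar : ∀ w ∈ Metric.ball w₀ R, Y w = 0 → V w = vStar := by
    intro w hw hYw
    have h := (hY w hw).2.2
    rw [show Q.ℓ (V w) - y = 0 from hYw, norm_zero, mul_zero, norm_le_zero_iff, sub_eq_zero] at h
    exact h
  have hw₀ρ : w₀ ∈ Metric.ball w₀ ρ := Metric.mem_ball_self hρ0
  have hYw₀ : ‖Y w₀‖ = ‖y‖ := by simp [hYdef, hV0]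
  obtain ⟨u, hu0, hu⟩ := hex w₀ hw₀ρ
  obtain ⟨huin, -, wStar, hws, hXs, hYs, hus⟩ := hlim u (by rw [hu0]; exact hw₀ρ) hu
  rw [hu0, hYw₀] at hus
  have hnorm : ‖wStar - w₀‖ ≤ a * K₀ * ‖S 0‖ := by
    have h := hus 0 le_rfl
    rw [hu0, mul_zero, Real.exp_zero, mul_one, norm_sub_rev] at h
    exact h.trans hay
  have hVs := hVstar wStar hws hYs
  refine ⟨wStar, ?_, ?_, hXs, hex, fun w hw0 hw => ?_⟩
  · rw [Metric.mem_ball, dist_eq_norm]; linarith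
  · refine hnorm.trans ?_
    have h1 := mul_pos hK₀ hK₀
    have h2 := mul_nonneg hK₀.le (norm_nonneg Q.ℓ)
    gcongr
    linarith
  obtain ⟨hin, hdec, wInf, hwI, hXI, hYI, hrate⟩ := hlim w hw0 hw
  have hVw : ∀ t : ℝ, 0 ≤ t → ‖V (w t) - V wStar‖ ≤
      K₀ * ‖Y (w 0)‖ * Real.exp (-c * t) := by
    intro t ht
    rw [hVs]
    refine ((hY _ (hin t ht)).2.2).trans ?_
    rw [mul_assoc, mul_comm ‖Y (w 0)‖]
    gcongr
    exact hdec t ht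
  refine ⟨fun hww₀ t ht => ⟨?_, ?_⟩, ⟨wInf, hXI, ?_, fun t ht => ?_⟩, fun t ht => ?_⟩
  · have heq := eqOn_of_solution_of_lipschitzOnWith (hκ.mono hbc) hw hu hin huin
      (hww₀.trans hu0.symm) ht
    rw [heq]
    refine (hus t ht).trans ?_
    have h1 := mul_pos ha0 hK₀
    have h2 := mul_pos hK₀ hK₀
    have h3 := mul_nonneg hK₀.le (norm_nonneg Q.ℓ)
    gcongr
    linarith
  · refine (hVw t ht).trans ?_
    rw [hww₀, hYw₀]
    have h1 : K₀ * ‖y‖ ≤ K₀ * K₀ * ‖S 0‖ := by rw [mul_assoc]; gcongr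
    refine mul_le_mul_of_nonneg_right (h1.trans ?_) (Real.exp_pos _).le
    have h2 := mul_pos ha0 hK₀
    have h3 := mul_nonneg hK₀.le (norm_nonneg Q.ℓ)
    gcongr
    linarith
  · rw [hVs, hVstar wInf hwI hYI]
  · refine (hrate t ht).trans ?_
    have h1 := mul_pos ha0 hK₀
    have h2 := mul_pos hK₀ hK₀
    have h3 := mul_nonneg hK₀.le (norm_nonneg Q.ℓ)
    have h4 := hsmall _ hw0
    have h5 := norm_nonneg (w 0 - w₀)
    gcongr
    linarith
  · refine (hVw t ht).trans ?_
    have e : Y (w 0) = Q.ℓ (V (w 0) - V wStar) := by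
      have h : Q.ℓ (V wStar) - y = 0 := hYs
      rw [map_sub, sub_eq_zero.1 h]
    have h1 : K₀ * ‖Y (w 0)‖ ≤ K₀ * ‖Q.ℓ‖ * ‖V (w 0) - V wStar‖ := by
      rw [e, mul_assoc]
      gcongr
      exact Q.ℓ.le_opNorm _
    refine mul_le_mul_of_nonneg_right (h1.trans ?_) (Real.exp_pos _).le
    have h2 := mul_pos ha0 hK₀
    have h3 := mul_pos hK₀ hK₀
    gcongr
    linarith

end Dynamics

/-! ### Accuracy of equilibria -/

section Accuracy

variable {W H : Type*} [NormedAddCommGroup W] [InnerProductSpace ℝ W] [CompleteSpace W]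
  [FiniteDimensional ℝ W] [NormedAddCommGroup H] [InnerProductSpace ℝ H] [CompleteSpace H]

/-- The orthogonal projection onto the range of `D` kills the kernel of `D^*`. -/
theorem starProjection_range_eq_zero (D : W →L[ℝ] H) {u : H}
    (hu : ContinuousLinearMap.adjoint D u = 0) :
    (LinearMap.range (D : W →ₗ[ℝ] H)).starProjection u = 0 := by
  refine Submodule.eq_starProjection_of_mem_of_inner_eq_zero (Submodule.zero_mem _) ?_
  rintro _ ⟨x, rfl⟩
  rw [sub_zero]
  change inner ℝ u (D x) = 0
  rw [← ContinuousLinearMap.adjoint_inner_left, hu, inner_zero_left]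

/-- An equilibrium `wStar` at distance `O(1/α)` from `w₀` is, up to `O(1/α)`, a fixed point of the
contraction `Π ∘ T`, where `Π` projects onto the tangent space at `w₀`: the model is tangent to
this space to first order, and so is the tangent space at `wStar`. -/
theorem exists_accuracy_bound {V : W → H} (hV : Differentiable ℝ V) {L : ℝ≥0}
    (hDV : LipschitzWith L (fderiv ℝ V)) {w₀ : W} (Q : RankChart V w₀) (hV0 : V w₀ = 0)
    {T : H → H} {k : ℝ} (hk1 : k ≤ 1)
    (hT : ∀ u v, ‖T u - T v‖ ≤ k * ‖u - v‖) {f : H} (hf : T f = f) {β : ℝ} (hβ : 0 ≤ β) :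
    ∃ C ≥ (0 : ℝ), ∀ α : ℝ, 1 ≤ α → ∀ w : W, ‖w - w₀‖ ≤ β / α →
      ContinuousLinearMap.adjoint (fderiv ℝ V w) (T (α • V w) - α • V w) = 0 →
      (1 - k) * ‖α • V w - f‖ ≤
        ‖(LinearMap.range (fderiv ℝ V w₀ : W →ₗ[ℝ] H)).starProjection f - f‖ + C / α := by
  set D₀ := fderiv ℝ V w₀ with hD₀
  set pr := (LinearMap.range (D₀ : W →ₗ[ℝ] H)).starProjection with hpr
  set N : ℝ := ‖D₀‖ * β + L * β ^ 2 with hN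
  have hN0 : 0 ≤ N := by positivity
  refine ⟨L * β ^ 2 + ‖Q.ℓ‖ * (L * β) * (2 * (N + ‖f‖)), by positivity,
    fun α hα w hw hadj => ?_⟩
  have hα0 : 0 < α := by linarith
  set v := α • V w with hv
  -- the model is tangent to the range of `D₀`
  have htan : ‖v - D₀ (α • (w - w₀))‖ ≤ L * β ^ 2 / α := by
    have h := norm_sub_sub_fderiv_le hV hDV w₀ w
    rw [hV0, sub_zero] at h
    rw [hv, map_smul, ← smul_sub, norm_smul, Real.norm_of_nonneg hα0.le]
    calc α * ‖V w - D₀ (w - w₀)‖ ≤ α * (L * (β / α) ^ 2) := by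
          gcongr
          exact h.trans (by gcongr)
      _ = L * β ^ 2 / α := by field_simp
  have hproj : ‖v - pr v‖ ≤ L * β ^ 2 / α := by
    have hx : pr (D₀ (α • (w - w₀))) = D₀ (α • (w - w₀)) :=
      Submodule.starProjection_eq_self_iff.2 ⟨_, rfl⟩
    have e : v - pr v = (LinearMap.range (D₀ : W →ₗ[ℝ] H))ᗮ.starProjection
        (v - D₀ (α • (w - w₀))) := by
      rw [Submodule.starProjection_orthogonal_val, ← hpr, map_sub, hx]; abel
    rw [e]
    exact (Submodule.norm_starProjection_apply_le _ _).trans htan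
  have hvN : ‖v‖ ≤ N := by
    have h1 := norm_le_insert' v (D₀ (α • (w - w₀)))
    have h2 : ‖D₀ (α • (w - w₀))‖ ≤ ‖D₀‖ * β := by
      refine (D₀.le_opNorm _).trans ?_
      rw [norm_smul, Real.norm_of_nonneg hα0.le]
      gcongr
      rw [le_div_iff₀ hα0] at hw
      linarith
    have h3 : L * β ^ 2 / α ≤ L * β ^ 2 := div_le_self (by positivity) hα
    linarith
  set u := T v - v with hu
  have huN : ‖u‖ ≤ 2 * (N + ‖f‖) := by
    have e : u = (T v - T f) - (v - f) := by rw [hu, hf]; abel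
    have h1 := norm_sub_le (T v - T f) (v - f)
    have h2 := hT v f
    have h3 : k * ‖v - f‖ ≤ 1 * ‖v - f‖ := by gcongr
    have h4 := norm_sub_le v f
    rw [e]
    linarith
  -- the residual is almost orthogonal to the range of `D₀`
  have hres : ‖pr u‖ ≤ ‖Q.ℓ‖ * (L * β) * (2 * (N + ‖f‖)) / α := by
    obtain ⟨x, hx⟩ : pr u ∈ LinearMap.range (D₀ : W →ₗ[ℝ] H) :=
      Submodule.starProjection_apply_mem _ _
    have hxD : D₀ (Q.ℓ (pr u)) = pr u := by
      have h1 : D₀ x = pr u := hx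
      rw [← h1, hD₀, ← Q.J_zero, Q.ℓ_J_zero, Q.J_P 0 Q.zero_mem_ball]
    set y := Q.ℓ (pr u) with hy
    have h1 : ‖pr u‖ ^ 2 = inner ℝ u ((D₀ - fderiv ℝ V w) y) := by
      have h2 : inner ℝ u (fderiv ℝ V w y) = 0 := by
        rw [← ContinuousLinearMap.adjoint_inner_left, hadj, inner_zero_left]
      rw [sub_apply, inner_sub_right, h2, sub_zero, hxD]
      have h3 : inner ℝ (u - pr u) (pr u) = 0 :=
        Submodule.starProjection_inner_eq_zero _ _ (Submodule.starProjection_apply_mem _ _)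
      rw [inner_sub_left, sub_eq_zero] at h3
      rw [h3, real_inner_self_eq_norm_sq]
    have hD : ‖D₀ - fderiv ℝ V w‖ ≤ L * (β / α) := by
      have h2 := hDV.dist_le_mul w w₀
      rw [dist_eq_norm, dist_eq_norm, norm_sub_rev] at h2
      exact h2.trans (by gcongr)
    have h4 : inner ℝ u ((D₀ - fderiv ℝ V w) y) ≤
        2 * (N + ‖f‖) * (L * (β / α) * (‖Q.ℓ‖ * ‖pr u‖)) := by
      refine (real_inner_le_norm _ _).trans ?_
      refine mul_le_mul huN (((D₀ - fderiv ℝ V w).le_opNorm y).trans ?_) (norm_nonneg _)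
        (by positivity)
      exact mul_le_mul hD (Q.ℓ.le_opNorm _) (norm_nonneg _) (by positivity)
    rcases (norm_nonneg (pr u)).eq_or_lt with h | h
    · rw [← h]; positivity
    · refine le_of_mul_le_mul_right ?_ h
      rw [← sq, h1]
      refine h4.trans_eq ?_
      ring
  have hsplit : v - f = (v - pr v) - pr u + pr (T v - T f) + (pr f - f) := by
    rw [hu, hf, map_sub, map_sub]; abel
  have hPT : ‖pr (T v - T f)‖ ≤ k * ‖v - f‖ :=
    (Submodule.norm_starProjection_apply_le _ _).trans (hT v f)
  have htri : ‖v - f‖ ≤ ‖v - pr v‖ + ‖pr u‖ + ‖pr (T v - T f)‖ + ‖pr f - f‖ := by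
    conv_lhs => rw [hsplit]
    refine (norm_add_le _ _).trans ?_
    gcongr
    refine (norm_add_le _ _).trans ?_
    gcongr
    exact norm_sub_le _ _
  rw [add_div]
  linarith

end Accuracy

/-! ### The Markov process -/

namespace MarkovRewardProcess

variable {S : Type*} [MeasurableSpace S] (M : MarkovRewardProcess S)

/-- The law of the state at time `n` as a kernel in the initial state. -/
noncomputable def marginal (n : ℕ) : Kernel S S := M.path.map fun ω => ω n

instance (n : ℕ) : IsMarkovKernel (M.marginal n) :=
  Kernel.IsMarkovKernel.map _ (measurable_pi_apply n)

theorem marginal_add (n m : ℕ) : M.marginal (n + m) = M.marginal n ∘ₖ M.marginal m := by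
  induction n with
  | zero =>
    rw [zero_add]
    conv_rhs => rw [marginal, path_map_zero, Kernel.id_comp]
  | succ n ih =>
    have h : ∀ j, M.marginal (j + 1) = M.P ∘ₖ M.marginal j := M.path_map_succ
    rw [show n + 1 + m = n + m + 1 by ring, h, ih, h, Kernel.comp_assoc]

theorem integral_path_eq_integral_marginal (n : ℕ) (s : S) {f : S → ℝ} (hf : Measurable f) :
    ∫ ω, f (ω n) ∂(M.path s) = ∫ x, f x ∂(M.marginal n s) := by
  rw [marginal, Kernel.map_apply _ (measurable_pi_apply n),
    integral_map (measurable_pi_apply n).aemeasurable hf.aestronglyMeasurable]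

/-- The expected immediate reward of a state. -/
noncomputable def expectedReward (x : S) : ℝ := ∫ y, M.r x y ∂(M.P x)

theorem measurable_expectedReward : Measurable M.expectedReward := by
  have := M.isMarkov
  exact (StronglyMeasurable.integral_kernel_prod_right
    (M.measurable_r.stronglyMeasurable : StronglyMeasurable (Function.uncurry M.r))).measurable

theorem abs_expectedReward_le {R : ℝ} (hR : ∀ s s', |M.r s s'| ≤ R) (x : S) :
    |M.expectedReward x| ≤ R := by
  have := M.isMarkov
  have h := norm_integral_le_of_norm_le_const (μ := M.P x) (f := fun y => M.r x y) (C := R)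
    (ae_of_all _ fun y => hR x y)
  simpa [expectedReward] using h

theorem measurable_reward (t : ℕ) : Measurable fun ω : ℕ → S => M.r (ω t) (ω (t + 1)) := by
  have h : Measurable fun ω : ℕ → S => Function.uncurry M.r (ω t, ω (t + 1)) :=
    M.measurable_r.comp ((measurable_pi_apply t).prodMk (measurable_pi_apply (t + 1)))
  exact h

theorem integrable_reward (t : ℕ) (s : S) :
    Integrable (fun ω : ℕ → S => M.r (ω t) (ω (t + 1))) (M.path s) := by
  obtain ⟨R, hR⟩ := M.bounded_r
  exact Integrable.of_bound (M.measurable_reward t).aestronglyMeasurable R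
    (ae_of_all _ fun ω => hR _ _)

/-- The Markov property at time `t`, applied to the reward of the next transition. -/
theorem integral_path_reward (t : ℕ) (s : S) :
    ∫ ω, M.r (ω t) (ω (t + 1)) ∂(M.path s) = ∫ x, M.expectedReward x ∂(M.marginal t s) := by
  obtain ⟨R, hR⟩ := M.bounded_r
  rw [← integral_path_eq_integral_marginal M t s M.measurable_expectedReward, path,
    Kernel.comap_apply]
  set x₀ : (i : Finset.Iic 0) → (fun _ : ℕ => S) i := fun _ => s
  have hjoint := Kernel.partialTraj_compProd_eq_map_traj (X := fun _ : ℕ => S) (κ := M.step)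
    (Nat.zero_le t) (x₀ := x₀)
  have hlast : Measurable fun x : (i : Finset.Iic t) → (fun _ : ℕ => S) i =>
      x ⟨t, Finset.mem_Iic.2 le_rfl⟩ := measurable_pi_apply _
  set g : ((i : Finset.Iic t) → (fun _ : ℕ => S) i) × S → ℝ :=
    fun z => M.r (z.1 ⟨t, Finset.mem_Iic.2 le_rfl⟩) z.2 with hg
  have hgm : Measurable g :=
    M.measurable_r.comp ((hlast.comp measurable_fst).prodMk measurable_snd)
  have hpair : Measurable fun x : (n : ℕ) → (fun _ : ℕ => S) n =>
      (Preorder.frestrictLe (π := fun _ : ℕ => S) t x, x (t + 1)) :=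
    (Preorder.measurable_frestrictLe t).prodMk (measurable_pi_apply (t + 1))
  have h1 : ∫ ω, M.r (ω t) (ω (t + 1)) ∂(Kernel.traj (X := fun _ => S) M.step 0 x₀) =
      ∫ z, g z ∂((Kernel.partialTraj (X := fun _ => S) M.step 0 t x₀) ⊗ₘ (M.step t)) := by
    rw [hjoint, integral_map hpair.aemeasurable hgm.aestronglyMeasurable]
    rfl
  rw [h1, Measure.integral_compProd (Integrable.of_bound hgm.aestronglyMeasurable R
    (ae_of_all _ fun z => hR _ _)), ← Kernel.traj_map_frestrictLe_apply,
    integral_map (Preorder.measurable_frestrictLe t).aemeasurable]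
  · rfl
  · exact (M.measurable_expectedReward.comp hlast).aestronglyMeasurable

/-- The value function is the discounted sum of the expected rewards. -/
theorem hasSum_valueFun (s : S) :
    HasSum (fun t : ℕ => M.γ ^ t * ∫ x, M.expectedReward x ∂(M.marginal t s)) (M.valueFun s) := by
  obtain ⟨R, hR⟩ := M.bounded_r
  have hγ := M.γ_pos.le
  have hb : ∀ t (ω : ℕ → S), ‖M.γ ^ t * M.r (ω t) (ω (t + 1))‖ ≤ M.γ ^ t * R := fun t ω => by
    rw [norm_mul, Real.norm_eq_abs, Real.norm_eq_abs, abs_of_nonneg (pow_nonneg hγ t)]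
    exact mul_le_mul_of_nonneg_left (hR _ _) (pow_nonneg hγ t)
  have hint : ∀ t : ℕ, Integrable (fun ω : ℕ → S => M.γ ^ t * M.r (ω t) (ω (t + 1))) (M.path s) :=
    fun t => (M.integrable_reward t s).const_mul _
  have h := hasSum_integral_of_summable_integral_norm hint (by
    refine Summable.of_nonneg_of_le (fun t => integral_nonneg fun ω => norm_nonneg _)
      (fun t => ?_) ((summable_geometric_of_lt_one hγ M.γ_lt_one).mul_right R)
    calc ∫ ω, ‖M.γ ^ t * M.r (ω t) (ω (t + 1))‖ ∂(M.path s) ≤ ∫ _ω, M.γ ^ t * R ∂(M.path s) :=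
          integral_mono (hint t).norm (integrable_const _) (hb t)
      _ = M.γ ^ t * R := by simp)
  simp only [integral_const_mul, integral_path_reward] at h
  exact h

theorem measurable_valueFun : Measurable M.valueFun := by
  have hmeas : Measurable fun ω : ℕ → S => ∑' t : ℕ, M.γ ^ t * M.r (ω t) (ω (t + 1)) :=
    Measurable.tsum fun t => (M.measurable_reward t).const_mul _
  exact (StronglyMeasurable.integral_kernel hmeas.stronglyMeasurable).measurable

/-- Markov property of the value function. -/
theorem hasSum_integral_valueFun (n : ℕ) (s : S) :
    HasSum (fun t : ℕ => M.γ ^ t * ∫ x, M.expectedReward x ∂(M.marginal (t + n) s))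
      (∫ ω, M.valueFun (ω n) ∂(M.path s)) := by
  obtain ⟨R, hR⟩ := M.bounded_r
  have hγ := M.γ_pos.le
  have hρ := M.measurable_expectedReward
  set e : ℕ → S → ℝ := fun t x => ∫ y, M.expectedReward y ∂(M.marginal t x) with he
  have hem : ∀ t, Measurable (e t) := fun t =>
    (StronglyMeasurable.integral_kernel hρ.stronglyMeasurable).measurable
  have heb : ∀ t x, ‖e t x‖ ≤ R := fun t x => by
    have h := norm_integral_le_of_norm_le_const (μ := M.marginal t x) (f := M.expectedReward)
      (C := R) (ae_of_all _ fun y => M.abs_expectedReward_le hR y)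
    simpa using h
  have hb : ∀ t x, ‖M.γ ^ t * e t x‖ ≤ M.γ ^ t * R := fun t x => by
    rw [norm_mul, Real.norm_of_nonneg (pow_nonneg hγ t)]
    exact mul_le_mul_of_nonneg_left (heb t x) (pow_nonneg hγ t)
  have hint : ∀ t : ℕ, Integrable (fun x => M.γ ^ t * e t x) (M.marginal n s) := fun t =>
    Integrable.of_bound ((hem t).const_mul _).aestronglyMeasurable _ (ae_of_all _ (hb t))
  have h := hasSum_integral_of_summable_integral_norm hint (by
    refine Summable.of_nonneg_of_le (fun t => integral_nonneg fun ω => norm_nonneg _)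
      (fun t => ?_) ((summable_geometric_of_lt_one hγ M.γ_lt_one).mul_right R)
    calc ∫ x, ‖M.γ ^ t * e t x‖ ∂(M.marginal n s) ≤ ∫ _x, M.γ ^ t * R ∂(M.marginal n s) :=
          integral_mono (hint t).norm (integrable_const _) (hb t)
      _ = M.γ ^ t * R := by simp)
  rw [integral_path_eq_integral_marginal M n s M.measurable_valueFun]
  have e1 : ∀ x, ∑' t : ℕ, M.γ ^ t * e t x = M.valueFun x := fun x => (M.hasSum_valueFun x).tsum_eq
  simp only [e1, integral_const_mul] at h
  convert! h using 3 with t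
  rw [marginal_add, Kernel.integral_comp]
  exact Integrable.of_bound hρ.aestronglyMeasurable R
    (ae_of_all _ fun y => M.abs_expectedReward_le hR y)

theorem integrable_partialReturn (m : ℕ) (s : S) : Integrable (fun ω : ℕ → S =>
    ∑ t ∈ Finset.range (m + 1), M.γ ^ t * M.r (ω t) (ω (t + 1))) (M.path s) :=
  integrable_finsetSum _ fun t _ => (M.integrable_reward t s).const_mul _

/-- The Bellman equation: the value function is a fixed point of the TD operator. -/
theorem tdFun_valueFun {lam : ℝ} (h0 : 0 ≤ lam) (h1 : lam < 1) :
    M.tdFun lam M.valueFun = M.valueFun := by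
  funext s
  have hint : ∀ m : ℕ, Integrable (fun ω : ℕ → S => M.valueFun (ω m)) (M.path s) := by
    intro m
    obtain ⟨R, hR⟩ := M.bounded_r
    refine Integrable.of_bound (M.measurable_valueFun.comp
      (measurable_pi_apply m)).aestronglyMeasurable ((1 - M.γ)⁻¹ * R) (ae_of_all _ fun ω => ?_)
    rw [← (M.hasSum_valueFun (ω m)).tsum_eq]
    have hg := (hasSum_geometric_of_lt_one M.γ_pos.le M.γ_lt_one).mul_right R
    refine tsum_of_norm_bounded hg fun t => ?_
    rw [norm_mul, Real.norm_of_nonneg (pow_nonneg M.γ_pos.le t)]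
    refine mul_le_mul_of_nonneg_left ?_ (pow_nonneg M.γ_pos.le t)
    have h := norm_integral_le_of_norm_le_const (μ := M.marginal t (ω m)) (f := M.expectedReward)
      (C := R) (ae_of_all _ fun y => M.abs_expectedReward_le hR y)
    simpa using h
  have hterm : ∀ m : ℕ, ∫ ω, ((∑ t ∈ Finset.range (m + 1), M.γ ^ t * M.r (ω t) (ω (t + 1)))
      + M.γ ^ (m + 1) * M.valueFun (ω (m + 1))) ∂(M.path s) = M.valueFun s := by
    intro m
    rw [integral_add (M.integrable_partialReturn m s) ((hint (m + 1)).const_mul _),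
      integral_finsetSum _ fun t _ => (M.integrable_reward t s).const_mul _]
    simp only [integral_const_mul, integral_path_reward]
    rw [← (M.hasSum_valueFun s).tsum_eq, ← (M.hasSum_integral_valueFun (m + 1) s).tsum_eq,
      ← tsum_mul_left, ← (M.hasSum_valueFun s).summable.sum_add_tsum_nat_add (m + 1)]
    congr 1
    refine tsum_congr fun t => ?_
    rw [pow_add]; ring
  simp only [tdFun, hterm]
  rw [tsum_mul_right, tsum_geometric_of_lt_one h0 h1, ← mul_assoc,
    mul_inv_cancel₀ (by linarith), one_mul]

end MarkovRewardProcess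

/-! ### The TD operator is a contraction of `L²(μ)` -/

namespace MarkovRewardProcess

variable {S : Type*} [MeasurableSpace S] (M : MarkovRewardProcess S)

/-- The contraction modulus `γ (1 - λ) / (1 - λ γ)` of the TD operator. -/
noncomputable def tdModulus (lam : ℝ) : ℝ := (1 - lam) * M.γ / (1 - lam * M.γ)

variable {lam : ℝ}

theorem lam_mul_γ_lt_one (h1 : lam < 1) : lam * M.γ < 1 := by
  nlinarith [M.γ_pos, M.γ_lt_one]

theorem tdModulus_nonneg (h1 : lam < 1) : 0 ≤ M.tdModulus lam := by
  have := M.lam_mul_γ_lt_one h1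
  exact div_nonneg (mul_nonneg (by linarith) M.γ_pos.le) (by linarith)

theorem one_sub_tdModulus (h1 : lam < 1) :
    1 - M.tdModulus lam = (1 - M.γ) / (1 - lam * M.γ) := by
  have := M.lam_mul_γ_lt_one h1
  have h : 1 - lam * M.γ ≠ 0 := by linarith
  rw [tdModulus, eq_div_iff h, sub_mul, div_mul_cancel₀ _ h]
  ring

theorem hasSum_tdModulus (h0 : 0 ≤ lam) (h1 : lam < 1) :
    HasSum (fun m : ℕ => (1 - lam) * (lam ^ m * M.γ ^ (m + 1))) (M.tdModulus lam) := by
  have h := (hasSum_geometric_of_lt_one (mul_nonneg h0 M.γ_pos.le)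
    (M.lam_mul_γ_lt_one h1)).mul_left ((1 - lam) * M.γ)
  rw [← div_eq_mul_inv] at h
  have e : (fun m : ℕ => (1 - lam) * (lam ^ m * M.γ ^ (m + 1))) =
      fun m : ℕ => (1 - lam) * M.γ * (lam * M.γ) ^ m := by
    funext m
    rw [mul_pow]; ring
  rw [e, tdModulus]
  exact h

/-- The measure through which the TD operator averages a function: the discounted law of the state
at a geometric time. Its total mass is the contraction modulus. -/
noncomputable def tdMeasure (lam : ℝ) (s : S) : Measure S :=
  Measure.sum fun m : ℕ =>
    ENNReal.ofReal ((1 - lam) * (lam ^ m * M.γ ^ (m + 1))) • M.marginal (m + 1) s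

theorem lintegral_tdMeasure (s : S) (f : S → ℝ≥0∞) :
    ∫⁻ x, f x ∂(M.tdMeasure lam s) =
      ∑' m : ℕ, ENNReal.ofReal ((1 - lam) * (lam ^ m * M.γ ^ (m + 1))) *
        ∫⁻ x, f x ∂(M.marginal (m + 1) s) := by
  rw [tdMeasure, lintegral_sum_measure]
  exact tsum_congr fun m => by rw [lintegral_smul_measure, smul_eq_mul]

theorem tsum_ofReal_tdModulus (h0 : 0 ≤ lam) (h1 : lam < 1) :
    ∑' m : ℕ, ENNReal.ofReal ((1 - lam) * (lam ^ m * M.γ ^ (m + 1))) =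
      ENNReal.ofReal (M.tdModulus lam) := by
  have hs := M.hasSum_tdModulus h0 h1
  rw [← hs.tsum_eq, ENNReal.ofReal_tsum_of_nonneg (fun m => ?_) hs.summable]
  exact mul_nonneg (by linarith) (mul_nonneg (pow_nonneg h0 m) (pow_nonneg M.γ_pos.le _))

theorem tdMeasure_univ (h0 : 0 ≤ lam) (h1 : lam < 1) (s : S) :
    M.tdMeasure lam s Set.univ = ENNReal.ofReal (M.tdModulus lam) := by
  have h := M.lintegral_tdMeasure (lam := lam) s (fun _ => 1)
  simpa [M.tsum_ofReal_tdModulus h0 h1] using h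

theorem lintegral_lintegral_marginal {μ : Measure S} (hμ : Kernel.Invariant M.P μ) (n : ℕ)
    {f : S → ℝ≥0∞} (hf : Measurable f) :
    ∫⁻ s, ∫⁻ x, f x ∂(M.marginal n s) ∂μ = ∫⁻ s, f s ∂μ := by
  rw [← lintegral_lintegral_path M μ hμ n hf]
  refine lintegral_congr fun s => ?_
  rw [marginal, Kernel.map_apply _ (measurable_pi_apply n), lintegral_map hf (measurable_pi_apply n)]

/-- Stationarity of `μ`, averaged over the geometric time. -/
theorem lintegral_lintegral_tdMeasure (h0 : 0 ≤ lam) (h1 : lam < 1) {μ : Measure S}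
    (hμ : Kernel.Invariant M.P μ) {f : S → ℝ≥0∞} (hf : Measurable f) :
    ∫⁻ s, ∫⁻ x, f x ∂(M.tdMeasure lam s) ∂μ =
      ENNReal.ofReal (M.tdModulus lam) * ∫⁻ s, f s ∂μ := by
  simp_rw [lintegral_tdMeasure]
  have hm : ∀ m : ℕ, Measurable fun s => ∫⁻ x, f x ∂(M.marginal (m + 1) s) := fun m =>
    hf.lintegral_kernel
  rw [lintegral_tsum fun m => ((hm m).const_mul _).aemeasurable]
  simp_rw [lintegral_const_mul _ (hm _), M.lintegral_lintegral_marginal hμ _ hf]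
  rw [ENNReal.tsum_mul_right, M.tsum_ofReal_tdModulus h0 h1]

/-- At almost every initial state the expectations and the series in `tdFun v` converge. -/
theorem ae_integrable_and_summable (h0 : 0 ≤ lam) (h1 : lam < 1) {μ : Measure S}
    (hμ : Kernel.Invariant M.P μ) {v : S → ℝ} (hv : Measurable v) (hvi : Integrable v μ) :
    ∀ᵐ s ∂μ, (∀ n : ℕ, Integrable (fun ω : ℕ → S => v (ω n)) (M.path s)) ∧
      Summable fun m : ℕ => lam ^ m * ∫ ω, ((∑ t ∈ Finset.range (m + 1),
        M.γ ^ t * M.r (ω t) (ω (t + 1))) + M.γ ^ (m + 1) * v (ω (m + 1))) ∂(M.path s) := by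
  have hve : Measurable fun x => ‖v x‖ₑ := hv.enorm
  have hfin : ∫⁻ x, ‖v x‖ₑ ∂μ ≠ ∞ := hvi.2.ne
  have hI : ∀ n : ℕ, ∀ᵐ s ∂μ, Integrable (fun ω : ℕ → S => v (ω n)) (M.path s) := by
    intro n
    have hm : Measurable fun s => ∫⁻ ω, ‖v (ω n)‖ₑ ∂(M.path s) :=
      Measurable.lintegral_kernel (hve.comp (measurable_pi_apply n))
    filter_upwards [ae_lt_top hm (by rwa [lintegral_lintegral_path M μ hμ n hve])] with s hs
    exact ⟨(hv.comp (measurable_pi_apply n)).aestronglyMeasurable, hs⟩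
  have hK : ∀ᵐ s ∂μ, ∫⁻ x, ‖v x‖ₑ ∂(M.tdMeasure lam s) < ∞ := by
    refine ae_lt_top ?_ ?_
    · simp_rw [lintegral_tdMeasure]
      exact Measurable.tsum fun m => hve.lintegral_kernel.const_mul _
    · rw [M.lintegral_lintegral_tdMeasure h0 h1 hμ hve]
      exact ENNReal.mul_ne_top ENNReal.ofReal_ne_top hfin
  filter_upwards [ae_all_iff.2 hI, hK] with s hs hKs
  refine ⟨hs, ?_⟩
  have hsplit : ∀ m : ℕ, lam ^ m * ∫ ω, ((∑ t ∈ Finset.range (m + 1),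
      M.γ ^ t * M.r (ω t) (ω (t + 1))) + M.γ ^ (m + 1) * v (ω (m + 1))) ∂(M.path s) =
      lam ^ m * (∑ t ∈ Finset.range (m + 1),
        M.γ ^ t * ∫ x, M.expectedReward x ∂(M.marginal t s)) +
      lam ^ m * (M.γ ^ (m + 1) * ∫ ω, v (ω (m + 1)) ∂(M.path s)) := by
    intro m
    rw [integral_add (M.integrable_partialReturn m s) ((hs (m + 1)).const_mul _),
      integral_finsetSum _ fun t _ => (M.integrable_reward t s).const_mul _]
    simp only [integral_const_mul, integral_path_reward]
    ring
  simp_rw [hsplit]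
  refine Summable.add ?_ ?_
  · -- the partial sums of the convergent series of the value function are bounded
    obtain ⟨B, hB⟩ := ((M.hasSum_valueFun s).tendsto_sum_nat.norm).bddAbove_range
    refine Summable.of_norm_bounded ((summable_geometric_of_lt_one h0 h1).mul_right B)
      fun m => ?_
    rw [norm_mul, Real.norm_of_nonneg (pow_nonneg h0 m)]
    exact mul_le_mul_of_nonneg_left (hB ⟨m + 1, rfl⟩) (pow_nonneg h0 m)
  · have h2 : Summable fun m : ℕ =>
        ((1 - lam) * (lam ^ m * M.γ ^ (m + 1))) * ∫ ω, v (ω (m + 1)) ∂(M.path s) := by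
      refine Summable.of_enorm (ne_top_of_le_ne_top hKs.ne ?_)
      rw [lintegral_tdMeasure]
      refine ENNReal.tsum_le_tsum fun m => ?_
      have hw : 0 ≤ (1 - lam) * (lam ^ m * M.γ ^ (m + 1)) :=
        mul_nonneg (by linarith) (mul_nonneg (pow_nonneg h0 m) (pow_nonneg M.γ_pos.le _))
      rw [enorm_mul, Real.enorm_of_nonneg hw]
      gcongr
      rw [M.integral_path_eq_integral_marginal _ _ hv]
      exact enorm_integral_le_lintegral_enorm _
    have h3 := h2.mul_left (1 - lam)⁻¹
    refine h3.congr fun m => ?_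
    have : 1 - lam ≠ 0 := by linarith
    field_simp

theorem enorm_tdFun_sub_le (h0 : 0 ≤ lam) (h1 : lam < 1) {μ : Measure S}
    (hμ : Kernel.Invariant M.P μ) {v v' : S → ℝ} (hv : Measurable v) (hvi : Integrable v μ)
    (hv' : Measurable v') (hvi' : Integrable v' μ) :
    ∀ᵐ s ∂μ, ‖M.tdFun lam v s - M.tdFun lam v' s‖ₑ ≤
      ∫⁻ x, ‖v x - v' x‖ₑ ∂(M.tdMeasure lam s) := by
  filter_upwards [M.ae_integrable_and_summable h0 h1 hμ hv hvi,
    M.ae_integrable_and_summable h0 h1 hμ hv' hvi'] with s hs hs'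
  have hdiff : M.tdFun lam v s - M.tdFun lam v' s = ∑' m : ℕ,
      (1 - lam) * (lam ^ m * M.γ ^ (m + 1)) * ∫ ω, (v (ω (m + 1)) - v' (ω (m + 1))) ∂(M.path s) := by
    rw [tdFun, tdFun, ← mul_sub, ← hs.2.tsum_sub hs'.2, ← tsum_mul_left]
    refine tsum_congr fun m => ?_
    rw [integral_add (M.integrable_partialReturn m s) ((hs.1 (m + 1)).const_mul _),
      integral_add (M.integrable_partialReturn m s) ((hs'.1 (m + 1)).const_mul _),
      integral_sub (hs.1 (m + 1)) (hs'.1 (m + 1)), integral_const_mul, integral_const_mul]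
    ring
  rw [hdiff, lintegral_tdMeasure]
  refine enorm_tsum_le_tsum_enorm.trans (ENNReal.tsum_le_tsum fun m => ?_)
  have hw : 0 ≤ (1 - lam) * (lam ^ m * M.γ ^ (m + 1)) :=
    mul_nonneg (by linarith) (mul_nonneg (pow_nonneg h0 m) (pow_nonneg M.γ_pos.le _))
  rw [enorm_mul, Real.enorm_of_nonneg hw]
  gcongr
  rw [M.integral_path_eq_integral_marginal (m + 1) s (f := fun x => v x - v' x) (hv.sub hv')]
  exact enorm_integral_le_lintegral_enorm _

/-- The contraction estimate for functions; it also shows that `tdFun v` depends, up to null sets,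
only on the class of `v`. -/
theorem eLpNorm_tdFun_sub_le (h0 : 0 ≤ lam) (h1 : lam < 1) {μ : Measure S} [IsProbabilityMeasure μ]
    (hμ : Kernel.Invariant M.P μ) {v v' : S → ℝ} (hv : Measurable v) (hv2 : MemLp v 2 μ)
    (hv' : Measurable v') (hv2' : MemLp v' 2 μ) :
    eLpNorm (fun s => M.tdFun lam v s - M.tdFun lam v' s) 2 μ ≤
      ENNReal.ofReal (M.tdModulus lam) * eLpNorm (fun s => v s - v' s) 2 μ := by
  set κ := ENNReal.ofReal (M.tdModulus lam)
  have hd : Measurable fun x => ‖v x - v' x‖ₑ := (hv.sub hv').enorm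
  have hle := M.enorm_tdFun_sub_le h0 h1 hμ hv (hv2.integrable (by norm_num)) hv'
    (hv2'.integrable (by norm_num))
  -- the Cauchy-Schwarz inequality for the averaging measure, of total mass `κ`
  have hCS : ∀ s, (∫⁻ x, ‖v x - v' x‖ₑ ∂(M.tdMeasure lam s)) ^ (2 : ℝ) ≤
      κ * ∫⁻ x, ‖v x - v' x‖ₑ ^ (2 : ℝ) ∂(M.tdMeasure lam s) := by
    intro s
    have h := ENNReal.lintegral_mul_le_Lp_mul_Lq (M.tdMeasure lam s) Real.HolderConjugate.two_two
      hd.aemeasurable (aemeasurable_const (b := (1 : ℝ≥0∞)))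
    simp only [Pi.mul_apply, mul_one, ENNReal.one_rpow, lintegral_const, one_mul,
      M.tdMeasure_univ h0 h1 s] at h
    refine (ENNReal.rpow_le_rpow h (by norm_num : (0 : ℝ) ≤ 2)).trans_eq ?_
    rw [ENNReal.mul_rpow_of_nonneg _ _ (by norm_num), ← ENNReal.rpow_mul, ← ENNReal.rpow_mul]
    norm_num
    rw [mul_comm]
  have hsq : ∫⁻ s, ‖M.tdFun lam v s - M.tdFun lam v' s‖ₑ ^ (2 : ℝ) ∂μ ≤
      κ * (κ * ∫⁻ s, ‖v s - v' s‖ₑ ^ (2 : ℝ) ∂μ) := by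
    rw [← M.lintegral_lintegral_tdMeasure h0 h1 hμ (hd.pow_const 2),
      ← lintegral_const_mul' _ _ ENNReal.ofReal_ne_top]
    refine lintegral_mono_ae ?_
    filter_upwards [hle] with s hs
    exact (ENNReal.rpow_le_rpow hs (by norm_num)).trans (hCS s)
  rw [eLpNorm_eq_lintegral_rpow_enorm_toReal (by norm_num) (by norm_num),
    eLpNorm_eq_lintegral_rpow_enorm_toReal (by norm_num) (by norm_num)]
  simp only [ENNReal.toReal_ofNat]
  refine (ENNReal.rpow_le_rpow hsq (by norm_num)).trans_eq ?_
  rw [← mul_assoc, ← sq, ENNReal.mul_rpow_of_nonneg _ _ (by norm_num), ← ENNReal.rpow_natCast,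
    ← ENNReal.rpow_mul]
  norm_num

variable (μ : Measure S) [IsProbabilityMeasure μ]

theorem td_eq_toLp (hμ : Kernel.Invariant M.P μ) (h0 : 0 ≤ lam) (h1 : lam < 1) (v : Lp ℝ 2 μ) :
    M.td μ lam v = (memLp_tdFun M μ hμ h0 h1 v).toLp _ := by
  rw [td, dif_pos (memLp_tdFun M μ hμ h0 h1 v)]

theorem norm_td_sub_le (hμ : Kernel.Invariant M.P μ) (h0 : 0 ≤ lam) (h1 : lam < 1)
    (u v : Lp ℝ 2 μ) : ‖M.td μ lam u - M.td μ lam v‖ ≤ M.tdModulus lam * ‖u - v‖ := by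
  have hk := M.tdModulus_nonneg h1
  have h := M.eLpNorm_tdFun_sub_le h0 h1 hμ (Lp.stronglyMeasurable u).measurable (Lp.memLp u)
    (Lp.stronglyMeasurable v).measurable (Lp.memLp v)
  rw [M.td_eq_toLp μ hμ h0 h1, M.td_eq_toLp μ hμ h0 h1, ← MemLp.toLp_sub, Lp.norm_toLp, Lp.norm_def,
    eLpNorm_congr_ae (Lp.coeFn_sub u v), ← ENNReal.toReal_ofReal hk, ← ENNReal.toReal_mul]
  refine ENNReal.toReal_mono (ENNReal.mul_ne_top ENNReal.ofReal_ne_top ?_) h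
  exact ((Lp.memLp u).sub (Lp.memLp v)).2.ne

theorem td_value (hμ : Kernel.Invariant M.P μ) (h0 : 0 ≤ lam) (h1 : lam < 1) :
    M.td μ lam (M.value μ) = M.value μ := by
  have hmem := memLp_valueFun M μ
  have hval : M.value μ = hmem.toLp _ := by rw [value, dif_pos hmem]
  have hae : (M.value μ : S → ℝ) =ᵐ[μ] M.valueFun := by
    rw [hval]; exact hmem.coeFn_toLp
  have h := M.eLpNorm_tdFun_sub_le h0 h1 hμ (Lp.stronglyMeasurable (M.value μ)).measurable
    (Lp.memLp (M.value μ)) M.measurable_valueFun hmem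
  rw [M.tdFun_valueFun h0 h1] at h
  have hz : eLpNorm (fun s => M.value μ s - M.valueFun s) 2 μ = 0 := by
    rw [eLpNorm_congr_ae (g := fun _ => (0 : ℝ)) (by
      filter_upwards [hae] with s hs
      rw [hs, sub_self])]
    simp
  rw [hz, mul_zero, nonpos_iff_eq_zero] at h
  have h' := (eLpNorm_eq_zero_iff
    ((memLp_tdFun M μ hμ h0 h1 (M.value μ)).sub hmem).1 (by norm_num)).1 h
  rw [M.td_eq_toLp μ hμ h0 h1]
  conv_rhs => rw [hval]
  rw [MemLp.toLp_eq_toLp_iff]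
  filter_upwards [h'] with s hs
  exact sub_eq_zero.1 hs

end MarkovRewardProcess

/-! ### Scaled TD dynamics -/

section Scaled

variable {H : Type*} [NormedAddCommGroup H] [InnerProductSpace ℝ H]

/-- The residual `v - (1/α) T (α v)` of the scaled operator. -/
noncomputable def scaledResidual (T : H → H) (α : ℝ) (v : H) : H := v - (1 / α) • T (α • v)

theorem norm_scaled_sub_le {T : H → H} {k : ℝ} (hT : ∀ u v, ‖T u - T v‖ ≤ k * ‖u - v‖) {α : ℝ}
    (hα : 0 < α) (u v : H) :
    ‖(1 / α) • T (α • u) - (1 / α) • T (α • v)‖ ≤ k * ‖u - v‖ := by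
  rw [← smul_sub, norm_smul, Real.norm_of_nonneg (by positivity)]
  have h := hT (α • u) (α • v)
  rw [← smul_sub, norm_smul, Real.norm_of_nonneg hα.le] at h
  calc 1 / α * ‖T (α • u) - T (α • v)‖ ≤ 1 / α * (k * (α * ‖u - v‖)) := by gcongr
    _ = k * ‖u - v‖ := by field_simp

theorem norm_scaledResidual_sub_le {T : H → H} {k : ℝ} (hk : k ≤ 1)
    (hT : ∀ u v, ‖T u - T v‖ ≤ k * ‖u - v‖) {α : ℝ} (hα : 0 < α) (u v : H) :
    ‖scaledResidual T α u - scaledResidual T α v‖ ≤ 2 * ‖u - v‖ := by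
  have e : scaledResidual T α u - scaledResidual T α v =
      (u - v) - ((1 / α) • T (α • u) - (1 / α) • T (α • v)) := by
    simp only [scaledResidual]; abel
  rw [e]
  have h1 := norm_sub_le (u - v) ((1 / α) • T (α • u) - (1 / α) • T (α • v))
  have h2 := norm_scaled_sub_le hT hα u v
  have h3 : k * ‖u - v‖ ≤ 1 * ‖u - v‖ := by gcongr
  linarith

theorem scaledResidual_stronglyMonotone {T : H → H} {k : ℝ}
    (hT : ∀ u v, ‖T u - T v‖ ≤ k * ‖u - v‖) {α : ℝ} (hα : 0 < α) (u v : H) :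
    (1 - k) * ‖u - v‖ ^ 2 ≤ inner ℝ (scaledResidual T α u - scaledResidual T α v) (u - v) := by
  have e : scaledResidual T α u - scaledResidual T α v =
      (u - v) - ((1 / α) • T (α • u) - (1 / α) • T (α • v)) := by
    simp only [scaledResidual]; abel
  rw [e, inner_sub_left, real_inner_self_eq_norm_sq]
  have h1 := real_inner_le_norm ((1 / α) • T (α • u) - (1 / α) • T (α • v)) (u - v)
  have h2 := norm_scaled_sub_le hT hα u v
  nlinarith [mul_le_mul_of_nonneg_right h2 (norm_nonneg (u - v))]

theorem norm_scaledResidual_zero (T : H → H) {α : ℝ} (hα : 0 < α) :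
    ‖scaledResidual T α 0‖ = ‖T 0‖ / α := by
  rw [scaledResidual, smul_zero, zero_sub, norm_neg, norm_smul,
    Real.norm_of_nonneg (by positivity)]
  ring

end Scaled

theorem MarkovRewardProcess.tdField_eq_pullbackField {S : Type*} [MeasurableSpace S]
    (M : MarkovRewardProcess S) (μ : Measure S) (lam : ℝ) {p : ℕ}
    (V : EuclideanSpace ℝ (Fin p) → Lp ℝ 2 μ) {α : ℝ} (hα : 0 < α) :
    M.tdField μ lam V α = pullbackField V (scaledResidual (M.td μ lam) α) := by
  funext w
  have e : scaledResidual (M.td μ lam) α (V w) =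
      -((1 / α) • (M.td μ lam (α • V w) - α • V w)) := by
    rw [scaledResidual, smul_sub, smul_smul, one_div_mul_cancel hα.ne', one_smul]; abel
  rw [tdField, pullbackField, e, map_neg, neg_neg, map_smul]

theorem theorem2 {S : Type*} [TopologicalSpace S] [CompactSpace S] [MeasurableSpace S]
    [BorelSpace S] (M : MarkovRewardProcess S) (μ : Measure S) (hμ : M.IsErgodic μ)
    (hsupp : μ.IsOpenPosMeasure) (lam : ℝ) (hlam0 : 0 ≤ lam) (hlam1 : lam < 1)
    (p : ℕ) (V : EuclideanSpace ℝ (Fin p) → Lp ℝ 2 μ) (hV : Differentiable ℝ V)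
    (L : ℝ≥0) (hDV : LipschitzWith L (fderiv ℝ V))
    (w₀ : EuclideanSpace ℝ (Fin p)) (r : ℕ)
    (hrank : ∀ᶠ w in 𝓝 w₀, Module.finrank ℝ (modelTangent V w) = r) (hV0 : V w₀ = 0) :
    ∃ α₀ > (0 : ℝ), ∃ ρ > (0 : ℝ), ∃ c > (0 : ℝ), ∃ K > (0 : ℝ), ∃ C > (0 : ℝ), ∀ α > α₀,
      ∃ wStar ∈ Metric.ball w₀ ρ,
        -- `wStar` is a fixed point of the dynamics
        M.tdField μ lam V α wStar = 0 ∧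
        -- the solution started at `w₀` converges to it exponentially fast
        (∃ w, M.IsTDSolution μ lam V α w ∧ w 0 = w₀) ∧
        (∀ w, M.IsTDSolution μ lam V α w → w 0 = w₀ → ∀ t : ℝ, 0 ≤ t →
          ‖w t - wStar‖ ≤ K * Real.exp (-c * t) ∧
          ‖α • V (w t) - α • V wStar‖ ≤ K * Real.exp (-c * t)) ∧
        -- `α • V wStar` attracts all solutions started near `w₀`, exponentially fast
        (∀ w₁ ∈ Metric.ball w₀ ρ,
          (∃ w, M.IsTDSolution μ lam V α w ∧ w 0 = w₁) ∧
          ∀ w, M.IsTDSolution μ lam V α w → w 0 = w₁ →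
            (∃ wInf, M.tdField μ lam V α wInf = 0 ∧ α • V wInf = α • V wStar ∧
              ∀ t : ℝ, 0 ≤ t → ‖w t - wInf‖ ≤ K * Real.exp (-c * t)) ∧
            ∀ t : ℝ, 0 ≤ t → ‖α • V (w t) - α • V wStar‖ ≤
              K * ‖α • V w₁ - α • V wStar‖ * Real.exp (-c * t)) ∧
        -- the projected TD error vanishes
        ‖tangentProj V wStar (M.td μ lam (α • V wStar) - α • V wStar)‖ = 0 ∧
        -- distance to the value function
        ‖α • V wStar - M.value μ‖ <
          (1 - lam * M.γ) / (1 - M.γ) * ‖tangentProj V w₀ (M.value μ) - M.value μ‖ + C / α := by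
  have := hμ.isProbability
  have hinv := hμ.invariant
  set T := M.td μ lam with hTdef
  set k := M.tdModulus lam with hkdef
  have hT : ∀ u v, ‖T u - T v‖ ≤ k * ‖u - v‖ := M.norm_td_sub_le μ hinv hlam0 hlam1
  have hTf : T (M.value μ) = M.value μ := M.td_value μ hinv hlam0 hlam1
  have h1k : 1 - k = (1 - M.γ) / (1 - lam * M.γ) := M.one_sub_tdModulus hlam1
  have hγ : 0 < 1 - M.γ := by linarith [M.γ_lt_one]
  have hlγ : 0 < 1 - lam * M.γ := by linarith [M.lam_mul_γ_lt_one hlam1]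
  have hk : 0 < 1 - k := by rw [h1k]; positivity
  obtain ⟨Q⟩ := exists_rankChart hV hDV hrank hV0
  obtain ⟨η, hη, ρ, hρ, c, hc, K, hK, hmain⟩ := exists_attracting_equilibrium hV hDV Q hV0 hk
  obtain ⟨C, hC, hacc⟩ := exists_accuracy_bound hV hDV Q hV0 (by linarith) hT hTf
    (β := K * ‖T 0‖) (by positivity)
  refine ⟨‖T 0‖ / η + 1, by positivity, ρ, hρ, c, hc, K * (1 + ‖T 0‖), by positivity,
    (C + 1) / (1 - k), by positivity, fun α hα => ?_⟩
  have hquot : 0 ≤ ‖T 0‖ / η := by positivity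
  have hα1 : 1 ≤ α := by linarith
  have hα0 : 0 < α := by linarith
  have hS0 : ‖scaledResidual T α 0‖ = ‖T 0‖ / α := norm_scaledResidual_zero T hα0
  obtain ⟨wStar, hws, hdist, hfix, hex, hsol⟩ := hmain (scaledResidual T α)
    (norm_scaledResidual_sub_le (by linarith) hT hα0) (scaledResidual_stronglyMonotone hT hα0) (by
      rw [hS0, div_le_iff₀ hα0]
      have h : ‖T 0‖ / η ≤ α := by linarith
      rw [div_le_iff₀ hη] at h
      linarith)
  have hfield := M.tdField_eq_pullbackField μ lam V hα0
  simp only [MarkovRewardProcess.IsTDSolution, hfield]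
  have hadj : ContinuousLinearMap.adjoint (fderiv ℝ V wStar)
      (T (α • V wStar) - α • V wStar) = 0 := by
    have h := hfix
    rw [← hfield, MarkovRewardProcess.tdField, smul_eq_zero] at h
    exact h.resolve_left (by positivity)
  have hexp : ∀ t : ℝ, 0 ≤ Real.exp (-c * t) := fun t => (Real.exp_pos _).le
  have hKK : K ≤ K * (1 + ‖T 0‖) := le_mul_of_one_le_right hK.le (by linarith [norm_nonneg (T 0)])
  have hαV : ∀ u v : EuclideanSpace ℝ (Fin p), ‖α • V u - α • V v‖ = α * ‖V u - V v‖ :=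
    fun u v => by rw [← smul_sub, norm_smul, Real.norm_of_nonneg hα0.le]
  refine ⟨wStar, hws, hfix, ?_, fun w hw hw0 t ht => ?_, fun w₁ hw₁ => ⟨?_, fun w hw hw0 => ?_⟩,
    ?_, ?_⟩
  · obtain ⟨w, hw0, hw⟩ := hex w₀ (Metric.mem_ball_self hρ)
    exact ⟨w, hw, hw0⟩
  · obtain ⟨h1, h2⟩ := (hsol w (by rw [hw0]; exact Metric.mem_ball_self hρ) hw).1 hw0 t ht
    refine ⟨h1.trans (mul_le_mul_of_nonneg_right hKK (hexp t)), ?_⟩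
    rw [hαV]
    calc α * ‖V (w t) - V wStar‖ ≤ α * (K * (‖T 0‖ / α) * Real.exp (-c * t)) := by
          rw [← hS0]; gcongr
      _ = K * ‖T 0‖ * Real.exp (-c * t) := by field_simp
      _ ≤ K * (1 + ‖T 0‖) * Real.exp (-c * t) := by gcongr; linarith
  · obtain ⟨w, hw0, hw⟩ := hex w₁ hw₁
    exact ⟨w, hw, hw0⟩
  · obtain ⟨-, ⟨wInf, h1, h2, h3⟩, h4⟩ := hsol w (by rw [hw0]; exact hw₁) hw
    refine ⟨⟨wInf, h1, by rw [h2], fun t ht =>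
      (h3 t ht).trans (mul_le_mul_of_nonneg_right hKK (hexp t))⟩, fun t ht => ?_⟩
    rw [hαV, hαV, ← hw0]
    calc α * ‖V (w t) - V wStar‖ ≤ α * (K * ‖V (w 0) - V wStar‖ * Real.exp (-c * t)) := by
          gcongr; exact h4 t ht
      _ = K * (α * ‖V (w 0) - V wStar‖) * Real.exp (-c * t) := by ring
      _ ≤ K * (1 + ‖T 0‖) * (α * ‖V (w 0) - V wStar‖) * Real.exp (-c * t) := by gcongr
  · rw [norm_eq_zero]
    exact starProjection_range_eq_zero (fderiv ℝ V wStar) hadj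
  · have h := hacc α hα1 wStar (by rw [mul_div_assoc, ← hS0]; exact hdist) hadj
    have e : (1 - lam * M.γ) / (1 - M.γ) = 1 / (1 - k) := by rw [h1k, one_div_div]
    have e2 : (C + 1) / (1 - k) / α = (C / α + 1 / α) / (1 - k) := by field_simp
    have hpos : 0 < 1 / α := by positivity
    rw [e, e2, one_div_mul_eq_div, ← add_div, lt_div_iff₀ hk, mul_comm]
    refine h.trans_lt ?_
    change ‖tangentProj V w₀ (M.value μ) - M.value μ‖ + C / α < _
    linarith
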